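/- Let $U\subseteq\mathbb C$ be open and, for $\omega\in U$, consider on $0<z<1$ the radial equation $\Psi''+P(z;\omega)\Psi'+Q(z;\omega)\Psi=0$. Assume it is of hypergeometric class: there are functions $a,b,c,\rho_0,\rho_1$ of $\omega$ such that, for every $f\in C^2(0,1)$, $\Psi=z^{\rho_0}(1-z)^{\rho_1}f$ solves it if and only if $z(1-z)f''+[c-(a+b+1)z]f'-ab\,f=0$. Let $w(z;\omega)=\exp\left(\int^z P(\zeta;\omega)\,d\zeta\right)$ be an integrating factor whose exponent (a primitive of $P$ in $z$) is analytic in $\omega\in U$ (if $P$ does not depend on $\omega$, one takes $w=w(z)$ and this is automatic). Assume $c(\omega)\notin\{0,-1,-2,\dots\}$ on $U$ and put $$R_{\rm in}=z^{\rho_0}(1-z)^{\rho_1}{}_2F_1(a,b;c;z),\qquad R_{\rm slow}=z^{\rho_0}(1-z)^{\rho_1}{}_2F_1(a,b;a+b-c+1;1-z),$$ $$R_{\rm fast}=z^{\rho_0}(1-z)^{\rho_1+c-a-b}{}_2F_1(c-a,c-b;c-a-b+1;1-z),$$ $$C_{\rm slow}=\frac{\Gamma(c)\Gamma(c-a-b)}{\Gamma(c-a)\Gamma(c-b)},\qquad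 C_{\rm fast}=\frac{\Gamma(c)\Gamma(a+b-c)}{\Gamma(a)\Gamma(b)}.$$ For constants $(\alpha,\beta)\in\mathbb C^2\setminus\{(0,0)\}$ let $F_{\alpha,\beta}=\alpha C_{\rm slow}+\beta C_{\rm fast}$ and $R_{\mathcal B}=\beta R_{\rm slow}-\alpha R_{\rm fast}$. With $W[u,v]=u\,\partial_zv-v\,\partial_zu$ and $W_{\rm sf}=W[R_{\rm slow},R_{\rm fast}]$, the Green's function is, for $z,z'\in(0,1)$, $z_<=\min(z,z')$, $z_>=\max(z,z')$, $$G(z,z';\omega)=\frac{R_{\rm in}(z_<;\omega)\,R_{\mathcal B}(z_>;\omega)}{w(z';\omega)\,W[R_{\rm in},R_{\mathcal B}](z';\omega)}.$$ Assume, on $U$: (A1) $a,b,c$ are analytic; (A2) $c-a-b\notin\mathbb Z$; (A3) $R_{\rm slow},R_{\rm fast}$ are linearly independent near $z=1$; (A4) $w\,W_{\rm sf}\neq0$ on $(0,1)$. Let $\omega_n\in U$ be a simple zero of $F_{\alpha,\beta}$: $F_{\alpha,\beta}(\omega_n)=0\neq F_{\alpha,\beta}'(\omega_n)$. Then there is $\chi_n\neq0$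 with $R_{\mathcal B}(z;\omega_n)=\chi_nR_{\rm in}(z;\omega_n)$ for all $z\in(0,1)$; if $\beta\ne0$ then $C_{\rm slow}(\omega_n)\neq0$ and $\chi_n=\beta/C_{\rm slow}(\omega_n)$, and if $\alpha\neq0$ then $C_{\rm fast}(\omega_n)\neq0$ and $\chi_n=-\alpha/C_{\rm fast}(\omega_n)$. For all $z,z'\in(0,1)$, $G(z,z';\cdot)$ is, near $\omega_n$, the sum of $\dfrac{r}{\omega-\omega_n}$ and a holomorphic function, with $$r=\operatorname{Res}_{\omega=\omega_n}G(z,z';\omega)=-\frac{\chi_n\,R_{\rm in}(z;\omega_n)\,R_{\rm in}(z';\omega_n)}{w(z';\omega_n)\,W_{\rm sf}(z';\omega_n)\,F_{\alpha,\beta}'(\omega_n)}.$$ It has a pole at $\omega_n$, of order exactly one, if and only if $R_{\rm in}(z;\omega_n)\neq0$ and $R_{\rm in}(z';\omega_n)\ne0$; the zeros of $R_{\rm in}(\cdot;\omega_n)$ have no accumulation point in $(0,1)$. Moreover $w(x;\omega_n)W_{\rm sf}(x;\omega_n)$ does not depend on $x\in(0,1)$. -/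

import Mathlib

open Set Filter Topology

noncomputable section

/-- The frequency-dependent parameters of a problem of the hypergeometric spectral class:
the Gauss parameters `a, b, c` and the local exponents `ρ₀` (at `z = 0`), `ρ₁` (at `z = 1`). -/
structure HypData where
  a : ℂ → ℂ
  b : ℂ → ℂ
  c : ℂ → ℂ
  ρ₀ : ℂ → ℂ
  ρ₁ : ℂ → ℂ

/-- `Ψ'' + P Ψ' + Q Ψ = 0` on `(0,1)`. -/
def SolvesRadial (P Q : ℝ → ℂ) (Ψ : ℝ → ℂ) : Prop :=
  ∀ z ∈ Ioo (0 : ℝ) 1, deriv (deriv Ψ) z + P z * deriv Ψ z + Q z * Ψ z = 0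

/-- The Gauss equation `z(1-z) f'' + [c - (a+b+1)z] f' - a b f = 0` on `(0,1)`. -/
def SolvesGauss (a b c : ℂ) (f : ℝ → ℂ) : Prop :=
  ∀ z ∈ Ioo (0 : ℝ) 1,
    (z : ℂ) * (1 - z) * deriv (deriv f) z + (c - (a + b + 1) * z) * deriv f z - a * b * f z = 0

/-- The Wronskian `W[u,v] = u v' - v u'` with respect to the radial variable. -/
def wronskian (u v : ℝ → ℂ) (z : ℝ) : ℂ := u z * deriv v z - v z * deriv u z

namespace HypData

variable (d : HypData)

/-- At the frequency `ω` the radial equation reduces to the Gauss equation: for twice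
continuously differentiable `f` on `(0,1)`, the field `Ψ = z^ρ₀ (1-z)^ρ₁ f` solves the radial
equation exactly when the residual function `f` solves the Gauss equation. -/
def ReducesToGauss (P Q : ℝ → ℂ → ℂ) (ω : ℂ) : Prop :=
  ∀ f : ℝ → ℂ, ContDiffOn ℝ 2 f (Ioo 0 1) →
    (SolvesRadial (fun z => P z ω) (fun z => Q z ω)
        (fun z => (z : ℂ) ^ d.ρ₀ ω * (1 - z : ℂ) ^ d.ρ₁ ω * f z) ↔
      SolvesGauss (d.a ω) (d.b ω) (d.c ω) f)

/-- The ingoing solution. -/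
def Rin (z : ℝ) (ω : ℂ) : ℂ :=
  (z : ℂ) ^ d.ρ₀ ω * (1 - z : ℂ) ^ d.ρ₁ ω * ₂F₁ (d.a ω) (d.b ω) (d.c ω) (z : ℂ)

/-- The slow Kummer branch at `z = 1`. -/
def Rslow (z : ℝ) (ω : ℂ) : ℂ :=
  (z : ℂ) ^ d.ρ₀ ω * (1 - z : ℂ) ^ d.ρ₁ ω *
    ₂F₁ (d.a ω) (d.b ω) (d.a ω + d.b ω - d.c ω + 1) (1 - z : ℂ)

/-- The fast Kummer branch at `z = 1`. -/
def Rfast (z : ℝ) (ω : ℂ) : ℂ :=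
  (z : ℂ) ^ d.ρ₀ ω * (1 - z : ℂ) ^ (d.ρ₁ ω + d.c ω - d.a ω - d.b ω) *
    ₂F₁ (d.c ω - d.a ω) (d.c ω - d.b ω) (d.c ω - d.a ω - d.b ω + 1) (1 - z : ℂ)

/-- The connection coefficient of the slow branch. Since `Complex.Gamma` is `0` at its poles and
`x / 0 = 0`, the quotient vanishes where a Gamma function of the denominator has a pole. -/
def Cslow (ω : ℂ) : ℂ :=
  Complex.Gamma (d.c ω) * Complex.Gamma (d.c ω - d.a ω - d.b ω) /
    (Complex.Gamma (d.c ω - d.a ω) * Complex.Gamma (d.c ω - d.b ω))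

/-- The connection coefficient of the fast branch. -/
def Cfast (ω : ℂ) : ℂ :=
  Complex.Gamma (d.c ω) * Complex.Gamma (d.a ω + d.b ω - d.c ω) /
    (Complex.Gamma (d.a ω) * Complex.Gamma (d.b ω))

/-- The quantization function `F_{α,β}`. -/
def F (α β : ℂ) (ω : ℂ) : ℂ := α * d.Cslow ω + β * d.Cfast ω

/-- The solution adapted to the outer boundary functional. -/
def RB (α β : ℂ) (z : ℝ) (ω : ℂ) : ℂ := β * d.Rslow z ω - α * d.Rfast z ω

/-- The Wronskian of the asymptotic basis. -/
def Wsf (z : ℝ) (ω : ℂ) : ℂ :=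
  wronskian (fun x => d.Rslow x ω) (fun x => d.Rfast x ω) z

/-- The frequency-domain Green's function for the integrating factor `w`. -/
def green (w : ℝ → ℂ → ℂ) (α β : ℂ) (z z' : ℝ) (ω : ℂ) : ℂ :=
  d.Rin (min z z') ω * d.RB α β (max z z') ω /
    (w z' ω * wronskian (fun x => d.Rin x ω) (fun x => d.RB α β x ω) z')

end HypData

/-- `f = r / (ω - ω₀) + (holomorphic)` near `ω₀`: an isolated singularity, a pole of order at most
one, with residue `r`. -/
def HasSimplePolePart (f : ℂ → ℂ) (ω₀ r : ℂ) : Prop :=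
  ∃ g : ℂ → ℂ, AnalyticAt ℂ g ω₀ ∧ ∀ᶠ ω in 𝓝[≠] ω₀, f ω = r / (ω - ω₀) + g ω

end

/-!
The ingoing solution is a combination of the two Kummer branches with the explicit Gamma quotients,
`Rin = Cslow * Rslow + Cfast * Rfast`. Bilinearity of the Wronskian then gives
`W[Rin, RB] = -F * Wsf`, so that
`green = -(Rin (z<) * RB (z>) / (w * Wsf)) / F`. The bracket is analytic in the frequency, hence a
simple zero of `F` gives a simple pole with the stated residue, and there `RB` is a multiple of
`Rin` because the coefficient vectors of `RB` and `Rin` in the basis `Rslow, Rfast` are parallel.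

Two points carry the work.

*The connection formula* (`ordinaryHypergeometric_connection`). Termwise differentiation of the
series gives three first-order relations: the formula for the derivative, and the contiguous
relations that lower and raise `c`. They imply the Gauss equation, so by Abel's identity the
solution at `0` is a combination of the two solutions at `1` with constant coefficients `s`, `t`.
Inserting this into the same relations gives `(c-a-b) s = (c-a)(c-b)/c * s(c+1)` and
`-(c-a-b) t = ab/c * t(a+1,b+1,c+1)` (`IsConnection.slow_shift`, `IsConnection.fast_shift`).
Iterating the first one, while `s(c+m) → 1` as `m → ∞`, produces Euler's limit for the Gamma
function and hence `s` (`IsConnection.slow_eq`). Euler's transformation gives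
`t(a,b,c) = s(c-a,c-b,c)` when `0 < re c`, and the second relation removes that restriction
(`IsConnection.fast_eq`).

*Analyticity in the frequency*. The exponents `ρ₀`, `ρ₁` are not assumed to be analytic. However,
two independent solutions determine `P` from the radial equation
(`HypData.ReducesToGauss.coeff_eq`), so the primitive `p` of `P` equals an explicit logarithmic
expression in `z` up to a constant in `z`. Thus the ratio of the prefactors `z ^ ρ₀ (1-z) ^ ρ₁` at
two points is the exponential of an analytic function of the frequency
(`HypData.analyticAt_exponentFactor_div`), and only such ratios enter the Green's function. The same
identity shows that `w * Wsf` does not depend on `z`.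
-/

/-! ### The hypergeometric series -/

theorem ordinaryHypergeometricCoefficient_zero (a b c : ℂ) :
    ordinaryHypergeometricCoefficient a b c 0 = 1 := by
  simp [ordinaryHypergeometricCoefficient]

theorem ordinaryHypergeometricCoefficient_succ (a b c : ℂ) (n : ℕ) :
    ordinaryHypergeometricCoefficient a b c (n + 1) =
      ordinaryHypergeometricCoefficient a b c n *
        ((a + n) * (b + n) / ((c + n) * (n + 1))) := by
  simp only [ordinaryHypergeometricCoefficient, ascPochhammer_succ_eval, Nat.factorial_succ,
    Nat.cast_mul, Nat.cast_succ, mul_inv, div_eq_mul_inv]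
  ring

theorem norm_ordinaryHypergeometricCoefficient_le {a b c : ℂ} {A B : ℝ} {e : ℕ → ℝ}
    (ha : ‖a‖ ≤ A) (hb : ‖b‖ ≤ B) (he : ∀ n, 0 < e n) (hc : ∀ n : ℕ, e n ≤ ‖c + n‖) (n : ℕ) :
    ‖ordinaryHypergeometricCoefficient a b c n‖ ≤
      ∏ j ∈ Finset.range n, (A + j) * (B + j) / (e j * (j + 1)) := by
  induction n with
  | zero => simp
  | succ n ih =>
    rw [ordinaryHypergeometricCoefficient_succ, Finset.prod_range_succ]
    generalize ordinaryHypergeometricCoefficient a b c n = t at ih ⊢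
    have h1 : ‖a + n‖ ≤ A + n := (norm_add_le _ _).trans (by simpa using ha)
    have h2 : ‖b + n‖ ≤ B + n := (norm_add_le _ _).trans (by simpa using hb)
    have h3 : ‖(n : ℂ) + 1‖ = n + 1 := by
      exact_mod_cast Complex.norm_natCast (n + 1)
    have hA : 0 ≤ A := (norm_nonneg _).trans ha
    have hB : 0 ≤ B := (norm_nonneg _).trans hb
    have hen := he n
    have hcn := hc n
    rw [norm_mul, norm_div, norm_mul, norm_mul, h3]
    gcongr
    exact (norm_nonneg t).trans ih

theorem summable_hypergeometricMajorant {A B K r : ℝ} {e : ℕ → ℝ} (hA : 0 ≤ A) (hB : 0 ≤ B)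
    (he : ∀ n, 0 < e n) (heK : ∀ n : ℕ, n - K ≤ e n) (hr0 : 0 ≤ r) (hr : r < 1) :
    Summable fun n : ℕ =>
      (∏ j ∈ Finset.range n, (A + j) * (B + j) / (e j * (j + 1))) * r ^ n := by
  obtain ⟨q, hrq, hq⟩ := exists_between hr
  refine summable_of_ratio_norm_eventually_le hq ?_
  have h1 : Tendsto (fun n : ℕ => (A + 1 * n) / (-K + 1 * n)) atTop (𝓝 (1 / 1)) :=
    tendsto_add_mul_div_add_mul_atTop_nhds _ _ _ one_ne_zero
  have h2 : Tendsto (fun n : ℕ => (B + 1 * n) / (1 + 1 * n)) atTop (𝓝 (1 / 1)) :=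
    tendsto_add_mul_div_add_mul_atTop_nhds _ _ _ one_ne_zero
  have h3 := (h1.mul h2).mul_const r
  rw [div_one, one_mul, one_mul] at h3
  filter_upwards [h3.eventually_le_const hrq, eventually_gt_atTop ⌈K⌉₊] with n hn hnK
  have hK : K < n := (Nat.le_ceil K).trans_lt (by exact_mod_cast hnK)
  have hp : 0 ≤ ∏ j ∈ Finset.range n, (A + j) * (B + j) / (e j * (j + 1)) :=
    Finset.prod_nonneg fun j _ => by have := he j; positivity
  have hen := he n
  have hle : (A + n) * (B + n) / (e n * (n + 1)) * r ≤ q := by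
    refine le_trans ?_ hn
    rw [div_mul_div_comm]
    have h4 := heK n
    have h5 : 0 < -K + 1 * (n : ℝ) := by linarith
    simp only [one_mul] at *
    rw [add_comm (1 : ℝ)]
    gcongr
    linarith
  rw [Finset.prod_range_succ, pow_succ, Real.norm_of_nonneg (by positivity),
    Real.norm_of_nonneg (by positivity)]
  calc _ = (A + n) * (B + n) / (e n * (n + 1)) * r *
        ((∏ j ∈ Finset.range n, (A + j) * (B + j) / (e j * (j + 1))) * r ^ n) := by ring
    _ ≤ _ := by gcongr

theorem exists_pos_forall_lt_norm_add_natCast {c : ℂ} (hc : ∀ k : ℕ, c ≠ -k) :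
    ∃ η : ℝ, 0 < η ∧ ∀ n : ℕ, η < ‖c + n‖ := by
  have h1 : ∀ᶠ η : ℝ in 𝓝[>] 0, ∀ n ∈ Finset.range ⌈‖c‖ + 1⌉₊, η < ‖c + n‖ := by
    rw [Filter.eventually_all_finset]
    intro n _
    refine nhdsWithin_le_nhds (gt_mem_nhds ?_)
    exact norm_pos_iff.2 fun h => hc n (eq_neg_of_add_eq_zero_left h)
  have h2 : ∀ᶠ η : ℝ in 𝓝[>] 0, η < 1 := nhdsWithin_le_nhds (gt_mem_nhds one_pos)
  obtain ⟨η, hη1, hη2, hη0⟩ := (h1.and (h2.and self_mem_nhdsWithin)).exists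
  refine ⟨η, hη0, fun n => ?_⟩
  by_cases hn : n < ⌈‖c‖ + 1⌉₊
  · exact hη1 n (Finset.mem_range.2 hn)
  · have h3 : ‖c‖ + 1 ≤ n := Nat.ceil_le.1 (not_lt.1 hn)
    have h4 : ‖(n : ℂ)‖ ≤ ‖c + n‖ + ‖c‖ := by
      calc ‖(n : ℂ)‖ = ‖(c + n) - c‖ := by ring_nf
        _ ≤ _ := norm_sub_le _ _
    rw [Complex.norm_natCast] at h4
    linarith

/-- Near a parameter triple with `c₀ ∉ {0, -1, …}` and for `‖x‖ ≤ r < 1` the terms of the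
hypergeometric series are dominated by one summable sequence. -/
theorem exists_summable_bound {c₀ : ℂ} (hc : ∀ k : ℕ, c₀ ≠ -k) {A B r : ℝ} (hA : 0 ≤ A)
    (hB : 0 ≤ B) (hr0 : 0 ≤ r) (hr : r < 1) :
    ∃ η > 0, ∃ u : ℕ → ℝ, Summable u ∧ ∀ a b c x : ℂ, ‖a‖ ≤ A → ‖b‖ ≤ B → ‖c - c₀‖ ≤ η →
      ‖x‖ ≤ r → ∀ n, ‖ordinaryHypergeometricCoefficient a b c n * x ^ n‖ ≤ u n := by
  obtain ⟨η, hη, hηc⟩ := exists_pos_forall_lt_norm_add_natCast hc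
  refine ⟨η, hη, _, summable_hypergeometricMajorant (K := ‖c₀‖ + η) (e := fun n => ‖c₀ + n‖ - η)
    hA hB (fun n => sub_pos.2 (hηc n)) (fun n => ?_) hr0 hr, ?_⟩
  · have h4 : ‖(n : ℂ)‖ ≤ ‖c₀ + n‖ + ‖c₀‖ := by
      calc ‖(n : ℂ)‖ = ‖(c₀ + n) - c₀‖ := by ring_nf
        _ ≤ _ := norm_sub_le _ _
    rw [Complex.norm_natCast] at h4
    linarith
  · intro a b c x ha hb hcη hx n
    rw [norm_mul, norm_pow]
    have hle : ∀ n : ℕ, ‖c₀ + n‖ - η ≤ ‖c + n‖ := fun n => by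
      have : ‖c₀ + n‖ ≤ ‖c + n‖ + ‖c - c₀‖ := by
        calc ‖c₀ + n‖ = ‖(c + n) - (c - c₀)‖ := by ring_nf
          _ ≤ _ := norm_sub_le _ _
      linarith
    have h1 := norm_ordinaryHypergeometricCoefficient_le ha hb
      (fun n => sub_pos.2 (hηc n)) hle n
    have h2 := (norm_nonneg _).trans h1
    gcongr

theorem summable_ordinaryHypergeometric (a b : ℂ) {c x : ℂ} (hc : ∀ k : ℕ, c ≠ -k)
    (hx : ‖x‖ < 1) :
    Summable fun n => ordinaryHypergeometricCoefficient a b c n * x ^ n := by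
  obtain ⟨η, hη, u, hu, h⟩ := exists_summable_bound hc (norm_nonneg a) (norm_nonneg b)
    (norm_nonneg x) hx
  exact .of_norm_bounded hu (h a b c x le_rfl le_rfl (by simp [hη.le]) le_rfl)

theorem hasSum_ordinaryHypergeometric (a b : ℂ) {c x : ℂ} (hc : ∀ k : ℕ, c ≠ -k)
    (hx : ‖x‖ < 1) :
    HasSum (fun n => ordinaryHypergeometricCoefficient a b c n * x ^ n) (₂F₁ a b c x) := by
  rw [ordinaryHypergeometric_eq_tsum]
  exact (summable_ordinaryHypergeometric a b hc hx).hasSum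

/-- `₂F₁` depends analytically on its parameters, away from `c ∈ {0, -1, …}`. -/
theorem analyticAt_ordinaryHypergeometric_param {a b c : ℂ → ℂ} {x ω₀ : ℂ}
    (ha : AnalyticAt ℂ a ω₀) (hb : AnalyticAt ℂ b ω₀) (hc : AnalyticAt ℂ c ω₀)
    (hc0 : ∀ k : ℕ, c ω₀ ≠ -k) (hx : ‖x‖ < 1) :
    AnalyticAt ℂ (fun ω => ₂F₁ (a ω) (b ω) (c ω) x) ω₀ := by
  obtain ⟨η, hη, u, hu, h⟩ := exists_summable_bound hc0 (A := ‖a ω₀‖ + 1) (B := ‖b ω₀‖ + 1)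
    (by positivity) (by positivity) (norm_nonneg x) hx
  have h1 : ∀ᶠ ω in 𝓝 ω₀, ‖a ω‖ ≤ ‖a ω₀‖ + 1 :=
    ha.continuousAt.norm.eventually_le_const (by simp)
  have h2 : ∀ᶠ ω in 𝓝 ω₀, ‖b ω‖ ≤ ‖b ω₀‖ + 1 :=
    hb.continuousAt.norm.eventually_le_const (by simp)
  have h3 : ∀ᶠ ω in 𝓝 ω₀, ‖c ω - c ω₀‖ ≤ η :=
    (hc.continuousAt.sub continuousAt_const).norm.eventually_le_const (by simp [hη])
  obtain ⟨η', hη', hηc⟩ := exists_pos_forall_lt_norm_add_natCast hc0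
  have h4 : ∀ᶠ ω in 𝓝 ω₀, ‖c ω - c ω₀‖ < η' :=
    (hc.continuousAt.sub continuousAt_const).norm.eventually_lt_const (by simp [hη'])
  obtain ⟨V, hV, hVo, hω⟩ := eventually_nhds_iff.1 (h1.and (h2.and (h3.and (h4.and
    (ha.eventually_analyticAt.and (hb.eventually_analyticAt.and hc.eventually_analyticAt))))))
  have key : DifferentiableOn ℂ (fun ω => ∑' n,
      ordinaryHypergeometricCoefficient (a ω) (b ω) (c ω) n * x ^ n) V := by
    refine Complex.differentiableOn_tsum_of_summable_norm hu (fun n => ?_) hVo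
      fun n ω hω => h _ _ _ _ (hV ω hω).1 (hV ω hω).2.1 (hV ω hω).2.2.1 le_rfl n
    refine DifferentiableOn.mul_const ?_ _
    intro ω hω
    refine DifferentiableAt.differentiableWithinAt ?_
    have ha' := (hV ω hω).2.2.2.2.1.differentiableAt
    have hb' := (hV ω hω).2.2.2.2.2.1.differentiableAt
    have hc' := (hV ω hω).2.2.2.2.2.2.differentiableAt
    induction n with
    | zero => simp
    | succ n ih =>
      simp_rw [ordinaryHypergeometricCoefficient_succ]
      refine ih.mul (((ha'.add_const _).mul (hb'.add_const _)).div
        ((hc'.add_const _).mul_const _) (mul_ne_zero ?_ (Nat.cast_add_one_ne_zero n)))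
      intro h0
      have h5 := hηc n
      have h6 := (hV ω hω).2.2.2.1
      have : c ω - c ω₀ = -(c ω₀ + n) := by linear_combination h0
      rw [this, norm_neg] at h6
      linarith
  have h5 := (key.analyticOnNhd hVo) ω₀ hω
  simp only [ordinaryHypergeometric_eq_tsum, smul_eq_mul]
  exact h5

/-- The derivative of `₂F₁`, together with its expansion by termwise differentiation. -/
theorem hasSum_deriv_ordinaryHypergeometric (a b : ℂ) {c x : ℂ} (hc : ∀ k : ℕ, c ≠ -k)
    (hx : ‖x‖ < 1) : ∃ y : ℂ, HasDerivAt (₂F₁ a b c) y x ∧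
      HasSum (fun n : ℕ => ordinaryHypergeometricCoefficient a b c n * (n * x ^ (n - 1))) y := by
  obtain ⟨r, hxr, hr⟩ := exists_between hx
  obtain ⟨η, hη, u, hu, h⟩ := exists_summable_bound hc (norm_nonneg a) (norm_nonneg b)
    ((norm_nonneg x).trans hxr.le) hr
  have hx' : x ∈ Metric.ball (0 : ℂ) r := by simpa using hxr
  have hd : ∀ n : ℕ, DifferentiableOn ℂ
      (fun x => ordinaryHypergeometricCoefficient a b c n * x ^ n) (Metric.ball 0 r) :=
    fun n => by fun_prop
  have hb : ∀ (n : ℕ), ∀ w ∈ Metric.ball (0 : ℂ) r,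
      ‖ordinaryHypergeometricCoefficient a b c n * w ^ n‖ ≤ u n := fun n w hw =>
    h a b c w le_rfl le_rfl (by simp [hη.le]) (by simpa using (mem_ball_zero_iff.1 hw).le) n
  have h1 := Complex.hasSum_deriv_of_summable_norm hu hd Metric.isOpen_ball hb hx'
  have h2 := (Complex.differentiableOn_tsum_of_summable_norm hu hd Metric.isOpen_ball
    hb).differentiableAt (Metric.isOpen_ball.mem_nhds hx')
  refine ⟨_, ?_, h1.congr_fun ?_⟩
  · rw [ordinaryHypergeometric_eq_tsum]
    exact h2.hasDerivAt
  · intro n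
    simp

/-! ### Contiguous relations and the Gauss equation -/

theorem succ_mul_ordinaryHypergeometricCoefficient_succ (a b : ℂ) {c : ℂ} (hc : ∀ k : ℕ, c ≠ -k)
    (n : ℕ) : (n + 1) * ordinaryHypergeometricCoefficient a b c (n + 1) =
      a * b / c * ordinaryHypergeometricCoefficient (a + 1) (b + 1) (c + 1) n := by
  have h0 : ∀ n : ℕ, c + n ≠ 0 := fun n h => hc n (eq_neg_of_add_eq_zero_left h)
  induction n with
  | zero =>
    have := h0 0
    simp only [ordinaryHypergeometricCoefficient_succ, ordinaryHypergeometricCoefficient_zero]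
    simp
  | succ n ih =>
    rw [ordinaryHypergeometricCoefficient_succ a b c (n + 1),
      ordinaryHypergeometricCoefficient_succ (a + 1) (b + 1) (c + 1) n]
    have h1 : (n : ℂ) + 1 ≠ 0 := Nat.cast_add_one_ne_zero n
    have h2 : (n : ℂ) + 1 + 1 ≠ 0 := by exact_mod_cast Nat.cast_add_one_ne_zero (R := ℂ) (n + 1)
    have h3 : c + (n + 1) ≠ 0 := by exact_mod_cast h0 (n + 1)
    have h4 : c + 1 + n ≠ 0 := by convert h3 using 1; ring
    rw [← mul_assoc (a * b / c), ← ih]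
    generalize ordinaryHypergeometricCoefficient a b c (n + 1) = t
    push_cast
    field_simp
    ring

theorem ordinaryHypergeometricCoefficient_add_one_right (a b : ℂ) {c : ℂ}
    (hc : ∀ k : ℕ, c ≠ -k) (n : ℕ) :
    (n + c) * ordinaryHypergeometricCoefficient a b (c + 1) n =
      c * ordinaryHypergeometricCoefficient a b c n := by
  have h0 : ∀ n : ℕ, c + n ≠ 0 := fun n h => hc n (eq_neg_of_add_eq_zero_left h)
  induction n with
  | zero => simp [ordinaryHypergeometricCoefficient_zero]
  | succ n ih =>
    rw [ordinaryHypergeometricCoefficient_succ a b c n,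
      ordinaryHypergeometricCoefficient_succ a b (c + 1) n, ← mul_assoc c, ← ih]
    have h1 : (n : ℂ) + 1 ≠ 0 := Nat.cast_add_one_ne_zero n
    have h3 : c + (n + 1) ≠ 0 := by exact_mod_cast h0 (n + 1)
    have h4 : c + 1 + n ≠ 0 := by convert h3 using 1; ring
    have h5 := h0 n
    generalize ordinaryHypergeometricCoefficient a b (c + 1) n = t
    push_cast
    field_simp
    ring

theorem add_one_ne_neg_natCast {c : ℂ} (hc : ∀ k : ℕ, c ≠ -k) (k : ℕ) : c + 1 ≠ -k := by
  intro h
  refine hc (k + 1) ?_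
  push_cast
  linear_combination h

theorem hasDerivAt_ordinaryHypergeometric (a b : ℂ) {c x : ℂ} (hc : ∀ k : ℕ, c ≠ -k)
    (hx : ‖x‖ < 1) :
    HasDerivAt (₂F₁ a b c) (a * b / c * ₂F₁ (a + 1) (b + 1) (c + 1) x) x := by
  obtain ⟨y, hy, hs⟩ := hasSum_deriv_ordinaryHypergeometric a b hc hx
  rw [← hasSum_nat_add_iff' 1] at hs
  have h1 := (hasSum_ordinaryHypergeometric (a + 1) (b + 1) (add_one_ne_neg_natCast hc)
    hx).mul_left (a * b / c)
  have h2 := hs.unique (h1.congr_fun fun n => ?_)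
  · simp only [Finset.sum_range_one, Nat.cast_zero, zero_mul, mul_zero, sub_zero] at h2
    rwa [← h2]
  · rw [← mul_assoc (a * b / c), ← succ_mul_ordinaryHypergeometricCoefficient_succ a b hc,
      Nat.add_sub_cancel]
    push_cast
    ring

/-- The contiguous relation lowering the third parameter. -/
theorem mul_deriv_ordinaryHypergeometric_add_one (a b : ℂ) {c x y : ℂ} (hc : ∀ k : ℕ, c ≠ -k)
    (hx : ‖x‖ < 1) (hy : HasDerivAt (₂F₁ a b (c + 1)) y x) :
    x * y + c * ₂F₁ a b (c + 1) x = c * ₂F₁ a b c x := by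
  have hc1 := add_one_ne_neg_natCast hc
  obtain ⟨y', hy', hs⟩ := hasSum_deriv_ordinaryHypergeometric a b hc1 hx
  obtain rfl := hy.unique hy'
  have h1 := (hs.mul_left x).add ((hasSum_ordinaryHypergeometric a b hc1 hx).mul_left c)
  refine h1.unique ?_
  convert (hasSum_ordinaryHypergeometric a b hc hx).mul_left c using 1
  ext n
  rw [← mul_assoc c (ordinaryHypergeometricCoefficient a b c n),
    ← ordinaryHypergeometricCoefficient_add_one_right a b hc]
  generalize ordinaryHypergeometricCoefficient a b (c + 1) n = t
  rcases n with _ | n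
  · simp
  · rw [Nat.add_sub_cancel]; ring

/-- The contiguous relation raising the third parameter. -/
theorem one_sub_mul_deriv_ordinaryHypergeometric (a b : ℂ) {c x y : ℂ} (hc : ∀ k : ℕ, c ≠ -k)
    (hx : ‖x‖ < 1) (hy : HasDerivAt (₂F₁ a b c) y x) :
    (1 - x) * y + (c - a - b) * ₂F₁ a b c x =
      (c - a) * (c - b) / c * ₂F₁ a b (c + 1) x := by
  have hc1 := add_one_ne_neg_natCast hc
  obtain ⟨y', hy', hs⟩ := hasSum_deriv_ordinaryHypergeometric a b hc hx
  obtain rfl := hy.unique hy'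
  have hs1 := hs
  rw [← hasSum_nat_add_iff' 1] at hs1
  have h1 := (hs1.sub (hs.mul_left x)).add
    ((hasSum_ordinaryHypergeometric a b hc hx).mul_left (c - a - b))
  have h2 := (hasSum_ordinaryHypergeometric a b hc1 hx).mul_left ((c - a) * (c - b) / c)
  have h0 : ∀ n : ℕ, c + n ≠ 0 := fun n h => hc n (eq_neg_of_add_eq_zero_left h)
  have hc0 : c ≠ 0 := by simpa using h0 0
  have h3 := h2.unique (h1.congr_fun fun n => ?_)
  · simp at h3
    linear_combination -h3
  · have h6 := ordinaryHypergeometricCoefficient_add_one_right a b hc n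
    have h7 : ordinaryHypergeometricCoefficient a b (c + 1) n =
        c * ordinaryHypergeometricCoefficient a b c n / (c + n) := by
      rw [eq_div_iff (h0 n), ← h6]; ring
    rw [h7, ordinaryHypergeometricCoefficient_succ]
    have h4 : (n : ℂ) + 1 ≠ 0 := Nat.cast_add_one_ne_zero n
    have h5 := h0 n
    generalize ordinaryHypergeometricCoefficient a b c n = t
    have h8 : x * (t * (n * x ^ (n - 1))) = t * n * x ^ n := by
      rcases n with _ | n
      · simp
      · rw [Nat.add_sub_cancel]; ring
    rw [h8, Nat.add_sub_cancel]
    push_cast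
    field_simp
    ring

/-- The Gauss equation, with the derivatives of `₂F₁ a b c` written as hypergeometric functions. -/
theorem ordinaryHypergeometric_gauss (a b : ℂ) {c x : ℂ} (hc : ∀ k : ℕ, c ≠ -k) (hx : ‖x‖ < 1) :
    x * (1 - x) * (a * b / c * ((a + 1) * (b + 1) / (c + 1) *
        ₂F₁ (a + 1 + 1) (b + 1 + 1) (c + 1 + 1) x)) +
      (c - (a + b + 1) * x) * (a * b / c * ₂F₁ (a + 1) (b + 1) (c + 1) x) -
      a * b * ₂F₁ a b c x = 0 := by
  have hc1 := add_one_ne_neg_natCast hc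
  have hc0 : c ≠ 0 := by simpa using hc 0
  have e1 : (fun w => (1 - w) * (a * b / c * ₂F₁ (a + 1) (b + 1) (c + 1) w) +
      (c - a - b) * ₂F₁ a b c w) =ᶠ[𝓝 x] fun w => (c - a) * (c - b) / c * ₂F₁ a b (c + 1) w := by
    have : ∀ᶠ w : ℂ in 𝓝 x, ‖w‖ < 1 := continuous_norm.continuousAt.eventually_lt_const hx
    filter_upwards [this] with w hw
    exact one_sub_mul_deriv_ordinaryHypergeometric a b hc hw
      (hasDerivAt_ordinaryHypergeometric a b hc hw)
  have d0 := hasDerivAt_ordinaryHypergeometric a b hc hx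
  have d1 := hasDerivAt_ordinaryHypergeometric (a + 1) (b + 1) hc1 hx
  have d2 := hasDerivAt_ordinaryHypergeometric a b hc1 hx
  have d3 := (((hasDerivAt_id x).const_sub 1).mul (d1.const_mul (a * b / c))).add
    (d0.const_mul (c - a - b))
  have h1 := (d3.congr_of_eventuallyEq e1.symm).unique (d2.const_mul _)
  have h2 := mul_deriv_ordinaryHypergeometric_add_one a b hc hx d2
  have h3 := e1.self_of_nhds
  simp only [id] at h1 h3
  generalize ₂F₁ (a + 1 + 1) (b + 1 + 1) (c + 1 + 1) x = f2 at *
  generalize ₂F₁ (a + 1) (b + 1) (c + 1) x = f1 at *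
  generalize ₂F₁ a b c x = f0 at *
  generalize ₂F₁ a b (c + 1) x = g at *
  generalize a * b / (c + 1) * ₂F₁ (a + 1) (b + 1) (c + 1 + 1) x = g1 at *
  have h4 : (c - a) * (c - b) / c * (c * f0) = (c - a) * (c - b) * f0 := by field_simp
  linear_combination x * h1 + c * h3 + (c - a) * (c - b) / c * h2 + h4

/-! ### Solutions of the Gauss equation on `(0,1)` and their Wronskians -/

/-- `f` is a twice differentiable solution of the Gauss equation on `(0,1)` with derivative `f'`;
the equation is solved for the second derivative. -/
structure IsGaussSolution (a b c : ℂ) (f f' : ℝ → ℂ) : Prop where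
  hasDerivAt : ∀ z ∈ Ioo (0 : ℝ) 1, HasDerivAt f (f' z) z
  hasDerivAt_deriv : ∀ z ∈ Ioo (0 : ℝ) 1, HasDerivAt f'
    ((a * b * f z - (c - (a + b + 1) * z) * f' z) / (z * (1 - z))) z

theorem ofReal_ne_zero_of_mem_Ioo {z : ℝ} (hz : z ∈ Ioo (0 : ℝ) 1) : (z : ℂ) ≠ 0 :=
  Complex.ofReal_ne_zero.2 hz.1.ne'

theorem one_sub_ofReal_ne_zero_of_mem_Ioo {z : ℝ} (hz : z ∈ Ioo (0 : ℝ) 1) : (1 - z : ℂ) ≠ 0 := by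
  rw [sub_ne_zero]
  exact_mod_cast hz.2.ne'

theorem norm_ofReal_lt_one {z : ℝ} (hz : z ∈ Ioo (0 : ℝ) 1) : ‖(z : ℂ)‖ < 1 := by
  rw [Complex.norm_real, Real.norm_of_nonneg hz.1.le]
  exact hz.2

theorem one_sub_mem_Ioo {z : ℝ} (hz : z ∈ Ioo (0 : ℝ) 1) : 1 - z ∈ Ioo (0 : ℝ) 1 :=
  ⟨by linarith [hz.2], by linarith [hz.1]⟩

theorem norm_one_sub_ofReal_lt_one {z : ℝ} (hz : z ∈ Ioo (0 : ℝ) 1) : ‖(1 - z : ℂ)‖ < 1 := by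
  simpa using norm_ofReal_lt_one (one_sub_mem_Ioo hz)

theorem cpow_mul_one_sub_cpow_ne_zero (s t : ℂ) {z : ℝ} (hz : z ∈ Ioo (0 : ℝ) 1) :
    (z : ℂ) ^ s * (1 - z : ℂ) ^ t ≠ 0 :=
  mul_ne_zero (by simp [Complex.cpow_eq_zero_iff, ofReal_ne_zero_of_mem_Ioo hz])
    (by simp [Complex.cpow_eq_zero_iff, one_sub_ofReal_ne_zero_of_mem_Ioo hz])

theorem hasDerivAt_ofReal_cpow_div (s : ℂ) {z : ℝ} (hz : z ∈ Ioo (0 : ℝ) 1) :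
    HasDerivAt (fun x : ℝ => (x : ℂ) ^ s) (s * (z : ℂ) ^ s / z) z := by
  have h := ((hasDerivAt_id (z : ℂ)).cpow_const (c := s)
    (Or.inl (by exact_mod_cast hz.1))).comp_ofReal
  convert! h using 1
  simp only [id, mul_one]
  rw [Complex.cpow_sub _ _ (ofReal_ne_zero_of_mem_Ioo hz), Complex.cpow_one, mul_div_assoc]

theorem hasDerivAt_one_sub_ofReal_cpow (s : ℂ) {z : ℝ} (hz : z ∈ Ioo (0 : ℝ) 1) :
    HasDerivAt (fun x : ℝ => (1 - x : ℂ) ^ s) (-(s * (1 - z : ℂ) ^ s / (1 - z))) z := by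
  have h := (((hasDerivAt_id (z : ℂ)).const_sub 1).cpow_const (c := s) (Or.inl (by simpa using hz.2))).comp_ofReal
  convert! h using 1
  simp only [id]
  rw [Complex.cpow_sub _ _ (one_sub_ofReal_ne_zero_of_mem_Ioo hz), Complex.cpow_one]
  ring

namespace IsGaussSolution

theorem ordinaryHypergeometric (a b : ℂ) {c : ℂ} (hc : ∀ k : ℕ, c ≠ -k) :
    IsGaussSolution a b c (fun z => ₂F₁ a b c (z : ℂ))
      (fun z => a * b / c * ₂F₁ (a + 1) (b + 1) (c + 1) (z : ℂ)) where
  hasDerivAt z hz := (hasDerivAt_ordinaryHypergeometric a b hc (norm_ofReal_lt_one hz)).comp_ofReal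
  hasDerivAt_deriv z hz := by
    have h := ((hasDerivAt_ordinaryHypergeometric (a + 1) (b + 1) (add_one_ne_neg_natCast hc)
      (norm_ofReal_lt_one hz)).const_mul (a * b / c)).comp_ofReal
    convert! h using 1
    have h0 := ofReal_ne_zero_of_mem_Ioo hz
    have h1 := one_sub_ofReal_ne_zero_of_mem_Ioo hz
    rw [div_eq_iff (mul_ne_zero h0 h1)]
    linear_combination -ordinaryHypergeometric_gauss a b hc (norm_ofReal_lt_one hz)

variable {a b c : ℂ} {u u' v v' : ℝ → ℂ}

/-- The Gauss equation is invariant under `z ↦ 1 - z`, `c ↦ a + b - c + 1`. -/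
theorem comp_one_sub (h : IsGaussSolution a b (a + b - c + 1) u u') :
    IsGaussSolution a b c (fun z => u (1 - z)) (fun z => -u' (1 - z)) where
  hasDerivAt z hz := by
    simpa using! (h.hasDerivAt _ (one_sub_mem_Ioo hz)).scomp z ((hasDerivAt_id z).const_sub 1)
  hasDerivAt_deriv z hz := by
    have h2 := ((h.hasDerivAt_deriv _ (one_sub_mem_Ioo hz)).scomp z
      ((hasDerivAt_id z).const_sub 1)).neg
    convert! h2 using 1
    have h0 := ofReal_ne_zero_of_mem_Ioo hz
    have h1 := one_sub_ofReal_ne_zero_of_mem_Ioo hz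
    have h3 : (1 : ℂ) - (1 - z) ≠ 0 := by simpa using h0
    push_cast
    simp only [neg_smul, one_smul, neg_neg]
    field_simp
    ring

/-- Euler's change of the dependent variable. -/
theorem one_sub_cpow_mul (h : IsGaussSolution (c - a) (c - b) c u u') :
    IsGaussSolution a b c (fun z => (1 - z : ℂ) ^ (c - a - b) * u z)
      (fun z => (1 - z : ℂ) ^ (c - a - b) * (u' z - (c - a - b) * u z / (1 - z))) where
  hasDerivAt z hz := by
    convert! (hasDerivAt_one_sub_ofReal_cpow (c - a - b) hz).mul (h.hasDerivAt z hz) using 1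
    ring
  hasDerivAt_deriv z hz := by
    have h0 := ofReal_ne_zero_of_mem_Ioo hz
    have h1 := one_sub_ofReal_ne_zero_of_mem_Ioo hz
    have h2 : HasDerivAt (fun x : ℝ => (1 - x : ℂ)) (-1) z := by
      simpa using! ((hasDerivAt_id (z : ℂ)).const_sub 1).comp_ofReal
    convert! (hasDerivAt_one_sub_ofReal_cpow (c - a - b) hz).mul ((h.hasDerivAt_deriv z hz).sub
      (((h.hasDerivAt z hz).const_mul (c - a - b)).div h2 h1)) using 1
    simp only [Pi.sub_apply, Pi.div_apply]
    field_simp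
    ring

/-- Abel's identity: the weight `z ^ c * (1 - z) ^ (a + b - c + 1)` makes the Wronskian of two
solutions constant. -/
theorem exists_wronskian_eq (hu : IsGaussSolution a b c u u') (hv : IsGaussSolution a b c v v') :
    ∃ k : ℂ, ∀ z ∈ Ioo (0 : ℝ) 1,
      (z : ℂ) ^ c * (1 - z : ℂ) ^ (a + b - c + 1) * (u z * v' z - v z * u' z) = k := by
  have hd : ∀ z ∈ Ioo (0 : ℝ) 1, HasDerivAt (fun z : ℝ => (z : ℂ) ^ c *
      (1 - z : ℂ) ^ (a + b - c + 1) * (u z * v' z - v z * u' z)) 0 z := fun z hz => by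
    have h0 := ofReal_ne_zero_of_mem_Ioo hz
    have h1 := one_sub_ofReal_ne_zero_of_mem_Ioo hz
    convert! ((hasDerivAt_ofReal_cpow_div c hz).mul
      (hasDerivAt_one_sub_ofReal_cpow (a + b - c + 1) hz)).mul
      (((hu.hasDerivAt z hz).mul (hv.hasDerivAt_deriv z hz)).sub
      ((hv.hasDerivAt z hz).mul (hu.hasDerivAt_deriv z hz))) using 1
    simp only [Pi.sub_apply, Pi.mul_apply]
    field_simp
    ring
  exact isOpen_Ioo.exists_is_const_of_deriv_eq_zero isPreconnected_Ioo
    (fun z hz => (hd z hz).differentiableAt.differentiableWithinAt) fun z hz => (hd z hz).deriv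

/-- Solutions of the Gauss equation form a two-dimensional space: a pair with nonvanishing
Wronskian spans. -/
theorem exists_eq_add {y y' : ℝ → ℂ} (hu : IsGaussSolution a b c u u')
    (hv : IsGaussSolution a b c v v') (hy : IsGaussSolution a b c y y')
    (hW : ∀ z ∈ Ioo (0 : ℝ) 1, u z * v' z - v z * u' z ≠ 0) :
    ∃ s t : ℂ, ∀ z ∈ Ioo (0 : ℝ) 1, y z = s * u z + t * v z := by
  obtain ⟨k, hk⟩ := hu.exists_wronskian_eq hv
  obtain ⟨l, hl⟩ := hy.exists_wronskian_eq hv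
  obtain ⟨m, hm⟩ := hu.exists_wronskian_eq hy
  refine ⟨l / k, m / k, fun z hz => ?_⟩
  have h0 := cpow_mul_one_sub_cpow_ne_zero c (a + b - c + 1) hz
  have hk0 : k ≠ 0 := by
    rw [← hk z hz]
    exact mul_ne_zero h0 (hW z hz)
  field_simp
  rw [← hk z hz, ← hl z hz, ← hm z hz]
  ring

theorem congr_deriv (hu : IsGaussSolution a b c u u') (h : ∀ z ∈ Ioo (0 : ℝ) 1, u z = v z)
    (h' : ∀ z ∈ Ioo (0 : ℝ) 1, u' z = v' z) : IsGaussSolution a b c v v' where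
  hasDerivAt z hz := by
    rw [← h' z hz]
    refine (hu.hasDerivAt z hz).congr_of_eventuallyEq ?_
    filter_upwards [Ioo_mem_nhds hz.1 hz.2] with x hx using (h x hx).symm
  hasDerivAt_deriv z hz := by
    rw [← h' z hz, ← h z hz]
    refine (hu.hasDerivAt_deriv z hz).congr_of_eventuallyEq ?_
    filter_upwards [Ioo_mem_nhds hz.1 hz.2] with x hx using (h' x hx).symm

end IsGaussSolution

noncomputable section

/-! ### The Kummer solutions at `z = 1` -/

/-- The solution of the Gauss equation with exponent `0` at `z = 1`. -/
def kummerSlow (a b c : ℂ) (z : ℝ) : ℂ := ₂F₁ a b (a + b - c + 1) (1 - z : ℂ)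

/-- The derivative of `kummerSlow`. -/
def kummerSlowDeriv (a b c : ℂ) (z : ℝ) : ℂ :=
  -(a * b / (a + b - c + 1) * ₂F₁ (a + 1) (b + 1) (a + b - c + 1 + 1) (1 - z : ℂ))

/-- The solution of the Gauss equation with exponent `c - a - b` at `z = 1`. -/
def kummerFast (a b c : ℂ) (z : ℝ) : ℂ :=
  (1 - z : ℂ) ^ (c - a - b) * ₂F₁ (c - a) (c - b) (c - a - b + 1) (1 - z : ℂ)

/-- The derivative of `kummerFast`. -/
def kummerFastDeriv (a b c : ℂ) (z : ℝ) : ℂ :=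
  (1 - z : ℂ) ^ (c - a - b) *
    (-((c - a) * (c - b) / (c - a - b + 1) *
        ₂F₁ (c - a + 1) (c - b + 1) (c - a - b + 1 + 1) (1 - z : ℂ)) -
      (c - a - b) * ₂F₁ (c - a) (c - b) (c - a - b + 1) (1 - z : ℂ) / (1 - z))

variable {a b c : ℂ}

theorem slow_parameter_ne (hδ : ∀ k : ℤ, c - a - b ≠ k) (k : ℕ) : a + b - c + 1 ≠ -k := by
  intro h
  refine hδ (k + 1) ?_
  push_cast
  linear_combination -h

theorem fast_parameter_ne (hδ : ∀ k : ℤ, c - a - b ≠ k) (k : ℕ) : c - a - b + 1 ≠ -k := by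
  intro h
  refine hδ (-k - 1) ?_
  push_cast
  linear_combination h

theorem isGaussSolution_kummerSlow (hδ : ∀ k : ℤ, c - a - b ≠ k) :
    IsGaussSolution a b c (kummerSlow a b c) (kummerSlowDeriv a b c) := by
  refine (IsGaussSolution.ordinaryHypergeometric a b
    (slow_parameter_ne hδ)).comp_one_sub.congr_deriv (fun z _ => ?_) fun z _ => ?_
  · simp [kummerSlow]
  · simp [kummerSlowDeriv]

theorem isGaussSolution_kummerFast (hδ : ∀ k : ℤ, c - a - b ≠ k) :
    IsGaussSolution a b c (kummerFast a b c) (kummerFastDeriv a b c) := by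
  have e : c - a + (c - b) - c + 1 = c - a - b + 1 := by ring
  have h := IsGaussSolution.ordinaryHypergeometric (c - a) (c - b) (fast_parameter_ne hδ)
  rw [← e] at h
  refine h.comp_one_sub.one_sub_cpow_mul.congr_deriv (fun z _ => ?_) fun z _ => ?_
  · simp [kummerFast, e]
  · simp [kummerFastDeriv, e]

theorem tendsto_one_sub_ofReal : Tendsto (fun z : ℝ => (1 - z : ℂ)) (𝓝[<] 1) (𝓝 0) := by
  have : ContinuousAt (fun z : ℝ => (1 - z : ℂ)) 1 := by fun_prop
  simpa using! this.tendsto.mono_left nhdsWithin_le_nhds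

theorem tendsto_hypergeometric_one_sub (a b : ℂ) {c : ℂ} (hc : ∀ k : ℕ, c ≠ -k) :
    Tendsto (fun z : ℝ => ₂F₁ a b c (1 - z : ℂ)) (𝓝[<] 1) (𝓝 1) := by
  have h1 : ContinuousAt (₂F₁ a b c) (0 : ℂ) :=
    (hasDerivAt_ordinaryHypergeometric a b hc (by simp)).continuousAt
  have h3 := h1.tendsto.comp tendsto_one_sub_ofReal
  rwa [ordinaryHypergeometric_zero] at h3

/-- The constant of Abel's identity for the two Kummer solutions is `-(c - a - b)`, as its limit
at `z = 1` shows. -/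
theorem wronskian_kummer_ne_zero (hδ : ∀ k : ℤ, c - a - b ≠ k) {z : ℝ} (hz : z ∈ Ioo (0 : ℝ) 1) :
    kummerSlow a b c z * kummerFastDeriv a b c z -
      kummerFast a b c z * kummerSlowDeriv a b c z ≠ 0 := by
  obtain ⟨k, hk⟩ := (isGaussSolution_kummerSlow hδ).exists_wronskian_eq
    (isGaussSolution_kummerFast hδ)
  have h0 : c - a - b ≠ 0 := by simpa using hδ 0
  have hs := slow_parameter_ne hδ
  have hf := fast_parameter_ne hδ
  have t1 := tendsto_hypergeometric_one_sub a b hs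
  have t2 := tendsto_hypergeometric_one_sub (a + 1) (b + 1) (add_one_ne_neg_natCast hs)
  have t3 := tendsto_hypergeometric_one_sub (c - a) (c - b) hf
  have t4 := tendsto_hypergeometric_one_sub (c - a + 1) (c - b + 1)
    (add_one_ne_neg_natCast hf)
  have t5 : Tendsto (fun z : ℝ => (z : ℂ) ^ c) (𝓝[<] 1) (𝓝 1) := by
    have h : ContinuousAt (fun z : ℝ => (z : ℂ) ^ c) 1 :=
      (Complex.continuous_ofReal.continuousAt).cpow continuousAt_const (by simp)
    simpa using! h.tendsto.mono_left nhdsWithin_le_nhds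
  have t6 := t5.mul ((t1.mul (((tendsto_one_sub_ofReal.mul
    (t4.const_mul ((c - a) * (c - b) / (c - a - b + 1)))).neg).sub
    (t3.const_mul (c - a - b)))).add ((tendsto_one_sub_ofReal.mul t3).mul
    (t2.const_mul (a * b / (a + b - c + 1)))))
  have t7 : Tendsto (fun _ : ℝ => k) (𝓝[<] 1) (𝓝 (-(c - a - b))) := by
    refine (t6.congr' ?_).trans (by simp)
    filter_upwards [Ioo_mem_nhdsLT (zero_lt_one' ℝ)] with x hx
    have hx1 := one_sub_ofReal_ne_zero_of_mem_Ioo hx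
    rw [← hk x hx]
    have e : (1 - x : ℂ) ^ (a + b - c + 1) * (1 - x : ℂ) ^ (c - a - b) = 1 - x := by
      rw [← Complex.cpow_add _ _ hx1]
      ring_nf
      simp
    simp only [kummerSlow, kummerSlowDeriv, kummerFast, kummerFastDeriv]
    generalize ₂F₁ a b (a + b - c + 1) (1 - x : ℂ) = f1
    generalize ₂F₁ (a + 1) (b + 1) (a + b - c + 1 + 1) (1 - x : ℂ) = f2
    generalize ₂F₁ (c - a) (c - b) (c - a - b + 1) (1 - x : ℂ) = f3
    generalize ₂F₁ (c - a + 1) (c - b + 1) (c - a - b + 1 + 1) (1 - x : ℂ) = f4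
    generalize a * b / (a + b - c + 1) = p
    generalize (c - a) * (c - b) / (c - a - b + 1) = q
    generalize (1 - x : ℂ) ^ (a + b - c + 1) = X at e ⊢
    generalize (1 - x : ℂ) ^ (c - a - b) = Y at e ⊢
    generalize (x : ℂ) ^ c = Z
    have e2 : X * Y * ((c - a - b) * f3 / (1 - x)) = (c - a - b) * f3 := by
      rw [e]; field_simp
    linear_combination (f1 * q * f4 - f3 * p * f2) * Z * e + Z * f1 * e2
  have hk0 : k ≠ 0 := by
    rw [tendsto_nhds_unique tendsto_const_nhds t7]
    exact neg_ne_zero.2 h0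
  rw [← hk z hz] at hk0
  exact right_ne_zero_of_mul hk0

theorem kummer_linearIndependent (hδ : ∀ k : ℤ, c - a - b ≠ k) {s t : ℂ}
    (h : ∀ z ∈ Ioo (0 : ℝ) 1, s * kummerSlow a b c z + t * kummerFast a b c z = 0) :
    s = 0 ∧ t = 0 := by
  have hz : (1 / 2 : ℝ) ∈ Ioo (0 : ℝ) 1 := by norm_num
  have hW := wronskian_kummer_ne_zero hδ hz
  have h1 := h _ hz
  have h2 := (((isGaussSolution_kummerSlow hδ).hasDerivAt _ hz).const_mul s).add
    (((isGaussSolution_kummerFast hδ).hasDerivAt _ hz).const_mul t)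
  have h3 := h2.unique ((hasDerivAt_const (1 / 2 : ℝ) (0 : ℂ)).congr_of_eventuallyEq (by
    filter_upwards [Ioo_mem_nhds hz.1 hz.2] with x hx using h x hx))
  constructor
  · refine (mul_eq_zero.1 ?_).resolve_right hW
    linear_combination kummerFastDeriv a b c (1 / 2) * h1 - kummerFast a b c (1 / 2) * h3
  · refine (mul_eq_zero.1 ?_).resolve_right hW
    linear_combination kummerSlow a b c (1 / 2) * h3 - kummerSlowDeriv a b c (1 / 2) * h1

/-! ### Connection coefficients and their shift relations -/

/-- `s` and `t` are the coefficients of `₂F₁ a b c` in the Kummer basis at `z = 1`. -/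
def IsConnection (a b c s t : ℂ) : Prop :=
  ∀ z ∈ Ioo (0 : ℝ) 1, ₂F₁ a b c (z : ℂ) = s * kummerSlow a b c z + t * kummerFast a b c z

theorem exists_isConnection (hc : ∀ k : ℕ, c ≠ -k) (hδ : ∀ k : ℤ, c - a - b ≠ k) :
    ∃ s t, IsConnection a b c s t :=
  (isGaussSolution_kummerSlow hδ).exists_eq_add (isGaussSolution_kummerFast hδ)
    (IsGaussSolution.ordinaryHypergeometric a b hc) fun _ hz => wronskian_kummer_ne_zero hδ hz

theorem kummer_eq_of_eq (hδ : ∀ k : ℤ, c - a - b ≠ k) {s t s' t' : ℂ}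
    (h : ∀ z ∈ Ioo (0 : ℝ) 1, s * kummerSlow a b c z + t * kummerFast a b c z =
      s' * kummerSlow a b c z + t' * kummerFast a b c z) : s = s' ∧ t = t' := by
  have := kummer_linearIndependent hδ (s := s - s') (t := t - t') fun z hz => by
    linear_combination h z hz
  exact ⟨sub_eq_zero.1 this.1, sub_eq_zero.1 this.2⟩

namespace IsConnection

variable {s t s' t' : ℂ}

theorem deriv_eq (h : IsConnection a b c s t) (hc : ∀ k : ℕ, c ≠ -k)
    (hδ : ∀ k : ℤ, c - a - b ≠ k) {z : ℝ} (hz : z ∈ Ioo (0 : ℝ) 1) :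
    a * b / c * ₂F₁ (a + 1) (b + 1) (c + 1) (z : ℂ) =
      s * kummerSlowDeriv a b c z + t * kummerFastDeriv a b c z := by
  have h2 := (((isGaussSolution_kummerSlow hδ).hasDerivAt _ hz).const_mul s).add
    (((isGaussSolution_kummerFast hδ).hasDerivAt _ hz).const_mul t)
  refine ((IsGaussSolution.ordinaryHypergeometric a b hc).hasDerivAt z hz).unique
    (h2.congr_of_eventuallyEq ?_)
  filter_upwards [Ioo_mem_nhds hz.1 hz.2] with x hx using h x hx

/-- Comparison of both sides of the relation that raises `c`. -/
theorem slow_shift (h : IsConnection a b c s t) (h' : IsConnection a b (c + 1) s' t')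
    (hc : ∀ k : ℕ, c ≠ -k) (hδ : ∀ k : ℤ, c - a - b ≠ k) :
    (c - a - b) * s = (c - a) * (c - b) / c * s' := by
  have hδ' : ∀ k : ℤ, c + 1 - a - b ≠ k := fun k hk => hδ (k - 1) (by
    push_cast; linear_combination hk)
  refine (kummer_eq_of_eq hδ' (t := -(t * ((c - a) * (c - b) / (c - a - b + 1))))
    (t' := (c - a) * (c - b) / c * t') fun z hz => ?_).1
  have hz1 := one_sub_ofReal_ne_zero_of_mem_Ioo hz
  have r1 := one_sub_mul_deriv_ordinaryHypergeometric a b hc (norm_ofReal_lt_one hz)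
    (hasDerivAt_ordinaryHypergeometric a b hc (norm_ofReal_lt_one hz))
  rw [h.deriv_eq hc hδ hz, h z hz, h' z hz] at r1
  have hs : ∀ k : ℕ, a + b - c ≠ -k := fun k hk => hδ k (by
    push_cast; linear_combination -hk)
  have r2 := mul_deriv_ordinaryHypergeometric_add_one a b hs (norm_one_sub_ofReal_lt_one hz)
    (hasDerivAt_ordinaryHypergeometric a b (slow_parameter_ne hδ) (norm_one_sub_ofReal_lt_one hz))
  have e1 : a + b - (c + 1) + 1 = a + b - c := by ring
  have e2 : c - a + 1 - b = c - a - b + 1 := by ring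
  have e3 : c + 1 - a = c - a + 1 := by ring
  have e4 : c + 1 - b = c - b + 1 := by ring
  have e5 : (1 - z : ℂ) ^ (c - a - b + 1) = (1 - z : ℂ) ^ (c - a - b) * (1 - z) := by
    rw [Complex.cpow_add _ _ hz1, Complex.cpow_one]
  have e6 : (1 - z : ℂ) * ((c - a - b) * ₂F₁ (c - a) (c - b) (c - a - b + 1) (1 - z : ℂ) / (1 - z))
      = (c - a - b) * ₂F₁ (c - a) (c - b) (c - a - b + 1) (1 - z : ℂ) := by field_simp
  simp only [kummerSlow, kummerSlowDeriv, kummerFast, kummerFastDeriv, e1, e2, e3, e4, e5] at r1 ⊢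
  linear_combination r1 + s * r2 + t * (1 - z : ℂ) ^ (c - a - b) * e6

/-- Comparison of both sides of the formula for the derivative of `₂F₁`. -/
theorem fast_shift (h : IsConnection a b c s t)
    (h' : IsConnection (a + 1) (b + 1) (c + 1) s' t')
    (hc : ∀ k : ℕ, c ≠ -k) (hδ : ∀ k : ℤ, c - a - b ≠ k) :
    -(c - a - b) * t = a * b / c * t' := by
  have hδ' : ∀ k : ℤ, c + 1 - (a + 1) - (b + 1) ≠ k := fun k hk => hδ (k + 1) (by
    push_cast; linear_combination hk)
  refine (kummer_eq_of_eq hδ' (s := -(s * (a * b / (a + b - c + 1))))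
    (s' := a * b / c * s') fun z hz => ?_).2
  have hz1 := one_sub_ofReal_ne_zero_of_mem_Ioo hz
  have r1 := h.deriv_eq hc hδ hz
  rw [h' z hz] at r1
  have hf : ∀ k : ℕ, c - a - b ≠ -k := fun k hk => hδ (-k) (by
    push_cast; linear_combination hk)
  have r2 := mul_deriv_ordinaryHypergeometric_add_one (c - a) (c - b) hf
    (norm_one_sub_ofReal_lt_one hz) (hasDerivAt_ordinaryHypergeometric (c - a) (c - b)
      (fast_parameter_ne hδ) (norm_one_sub_ofReal_lt_one hz))
  have e1 : a + 1 + (b + 1) - (c + 1) + 1 = a + b - c + 1 + 1 := by ring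
  have e2 : c - a - (b + 1) = c - a - b - 1 := by ring
  have e3 : c + 1 - (a + 1) = c - a := by ring
  have e4 : c + 1 - (b + 1) = c - b := by ring
  have e5 : (1 - z : ℂ) ^ (c - a - b - 1) = (1 - z : ℂ) ^ (c - a - b) / (1 - z) := by
    rw [Complex.cpow_sub _ _ hz1, Complex.cpow_one]
  simp only [kummerSlow, kummerSlowDeriv, kummerFast, kummerFastDeriv, e1, e2, e3, e4, e5,
    sub_add_cancel] at r1 ⊢
  generalize ₂F₁ (c - a) (c - b) (c - a - b) (1 - z : ℂ) = f1 at *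
  generalize ₂F₁ (c - a) (c - b) (c - a - b + 1) (1 - z : ℂ) = f2 at *
  generalize ₂F₁ (c - a + 1) (c - b + 1) (c - a - b + 1 + 1) (1 - z : ℂ) = f3 at *
  generalize (1 - z : ℂ) ^ (c - a - b) = X at *
  have e6 : X / (1 - z) * ((1 - z) * ((c - a) * (c - b) / (c - a - b + 1) * f3) +
      (c - a - b) * f2) = X * ((c - a) * (c - b) / (c - a - b + 1) * f3 +
      (c - a - b) * f2 / (1 - z)) := by
    generalize (c - a) * (c - b) / (c - a - b + 1) = q
    field_simp
  rw [r2] at e6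
  linear_combination -r1 - t * e6

end IsConnection

end

/-! ### Values of the connection coefficients -/

theorem norm_ordinaryHypergeometric_sub_one_le {a b c : ℂ} {A : ℝ} (ha : ‖a‖ ≤ A) (hb : ‖b‖ ≤ A)
    (hM : 4 * (A + 1) ^ 2 ≤ c.re) {z : ℝ} (hz : z ∈ Ioo (0 : ℝ) 1) :
    ‖₂F₁ a b c (z : ℂ) - 1‖ ≤ 4 * A ^ 2 / c.re * ∑' n : ℕ, 1 / ((n : ℝ) + 2) ^ 2 := by
  set M := c.re
  have hA : 0 ≤ A := (norm_nonneg _).trans ha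
  have hM0 : 0 < M := lt_of_lt_of_le (by positivity) hM
  have hc : ∀ k : ℕ, c ≠ -k := fun k h => by
    have : M = -k := by simp [M, h]
    have : (0 : ℝ) ≤ k := Nat.cast_nonneg k
    linarith
  have hre : ∀ n : ℕ, M + n ≤ ‖c + n‖ := fun n => by
    simpa using! (Complex.re_le_norm (c + n))
  have hprod : ∀ n : ℕ, ∏ j ∈ Finset.range (n + 1), (A + j) * (A + j) / ((M + j) * ((j : ℝ) + 1)) ≤
      4 * A ^ 2 / M * (1 / ((n : ℝ) + 2) ^ 2) := by
    intro n
    induction n with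
    | zero =>
      simp only [zero_add, Finset.prod_range_one, Nat.cast_zero, add_zero, mul_one]
      apply le_of_eq
      field_simp
      norm_num
    | succ n ih =>
      rw [Finset.prod_range_succ]
      -- the cross-multiplied inequality holds coefficientwise in `n`
      have h1 : (A + (n + 1 : ℝ)) * (A + (n + 1)) / ((M + (n + 1)) * (n + 1 + 1)) ≤
          ((n : ℝ) + 2) ^ 2 / (n + 3) ^ 2 := by
        rw [div_le_div_iff₀ (by positivity) (by positivity)]
        obtain ⟨D, hD⟩ : ∃ D, M = 4 * (A + 1) ^ 2 + D := ⟨_, (add_sub_cancel _ _).symm⟩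
        have hD0 : 0 ≤ D := by linarith
        rw [hD, ← sub_nonneg]
        ring_nf
        positivity
      calc _ ≤ 4 * A ^ 2 / M * (1 / ((n : ℝ) + 2) ^ 2) * (((n : ℝ) + 2) ^ 2 / (n + 3) ^ 2) := by
            push_cast
            gcongr
        _ = _ := by
            push_cast
            field_simp
            ring
  have hs : Summable fun n : ℕ => 1 / ((n : ℝ) + 2) ^ 2 := by
    have := (summable_nat_add_iff 2).2 (Real.summable_one_div_nat_pow.2 one_lt_two)
    simpa using! this
  have h1 := hasSum_ordinaryHypergeometric a b hc (norm_ofReal_lt_one hz)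
  rw [← hasSum_nat_add_iff' 1] at h1
  simp only [Finset.sum_range_one, pow_zero, mul_one, ordinaryHypergeometricCoefficient_zero] at h1
  rw [← h1.tsum_eq, ← tsum_mul_left]
  refine tsum_of_norm_bounded (hs.mul_left _).hasSum fun n => ?_
  rw [norm_mul]
  have h2 := norm_ordinaryHypergeometricCoefficient_le ha hb (e := fun n => M + n)
    (fun n => by positivity) hre (n + 1)
  have h3 : ‖(z : ℂ) ^ (n + 1)‖ ≤ 1 := by
    rw [norm_pow]
    exact pow_le_one₀ (norm_nonneg _) (norm_ofReal_lt_one hz).le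
  exact (mul_le_of_le_one_right (norm_nonneg _) h3).trans (h2.trans (hprod n))

theorem tendsto_one_sub_cpow {s : ℂ} (hs : 0 < s.re) :
    Tendsto (fun z : ℝ => (1 - z : ℂ) ^ s) (𝓝[<] 1) (𝓝 0) := by
  have hs0 : s ≠ 0 := by rintro rfl; simp at hs
  have h := (Complex.continuousAt_cpow_zero_of_re_pos hs).tendsto.comp
    (tendsto_one_sub_ofReal.prodMk_nhds (tendsto_const_nhds (x := s)))
  simpa [Function.comp_def, Complex.zero_cpow hs0] using! h

theorem tendsto_zero_hypergeometric (a b : ℂ) {c : ℂ} (hc : ∀ k : ℕ, c ≠ -k) :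
    Tendsto (fun z : ℝ => ₂F₁ a b c (z : ℂ)) (𝓝[>] 0) (𝓝 1) := by
  have h1 : ContinuousAt (fun z : ℝ => ₂F₁ a b c (z : ℂ)) 0 :=
    ContinuousAt.comp (f := fun z : ℝ => (z : ℂ)) (g := ₂F₁ a b c) (by
      simpa using (hasDerivAt_ordinaryHypergeometric a b hc (x := 0) (by simp)).continuousAt)
      Complex.continuous_ofReal.continuousAt
  simpa using! h1.tendsto.mono_left nhdsWithin_le_nhds

namespace IsConnection

variable {a b c s t s' t' : ℂ}

theorem tendsto_one (h : IsConnection a b c s t) (hδ : ∀ k : ℤ, c - a - b ≠ k)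
    (hre : 0 < (c - a - b).re) : Tendsto (fun z : ℝ => ₂F₁ a b c (z : ℂ)) (𝓝[<] 1) (𝓝 s) := by
  have h1 := ((tendsto_hypergeometric_one_sub a b (slow_parameter_ne hδ)).const_mul s).add
    (((tendsto_one_sub_cpow hre).mul
      (tendsto_hypergeometric_one_sub (c - a) (c - b) (fast_parameter_ne hδ))).const_mul t)
  simp only [mul_one, mul_zero, add_zero] at h1
  refine h1.congr' ?_
  filter_upwards [Ioo_mem_nhdsLT (zero_lt_one' ℝ)] with x hx using (h x hx).symm

/-- Gauss's evaluation: raising `c` repeatedly multiplies the coefficient by the factors of Euler's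
limit formula for the Gamma function, and `₂F₁ a b c → 1` as `c → +∞`. -/
theorem slow_eq (h : IsConnection a b c s t) (hc : ∀ k : ℕ, c ≠ -k)
    (hδ : ∀ k : ℤ, c - a - b ≠ k) :
    s = Complex.Gamma c * Complex.Gamma (c - a - b) /
      (Complex.Gamma (c - a) * Complex.Gamma (c - b)) := by
  have hcm : ∀ m k : ℕ, c + m ≠ -k := fun m k hk => hc (m + k) (by
    push_cast; linear_combination hk)
  have hδm : ∀ (m : ℕ) (k : ℤ), c + m - a - b ≠ k := fun m k hk => hδ (k - m) (by
    push_cast; linear_combination hk)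
  choose S T hST using fun m => exists_isConnection (a := a) (b := b) (hcm m) (hδm m)
  have hS0 : S 0 = s := by
    refine (kummer_eq_of_eq hδ (t := T 0) (t' := t) fun z hz => ?_).1
    have := hST 0 z hz
    rw [Nat.cast_zero, add_zero] at this
    rw [← this, h z hz]
  have hstep : ∀ m : ℕ, S m = (c - a + m) * (c - b + m) / ((c + m) * (c - a - b + m)) *
      S (m + 1) := fun m => by
    have h1 := hST (m + 1)
    rw [Nat.cast_succ, ← add_assoc] at h1
    have h2 := (hST m).slow_shift h1 (hcm m) (hδm m)
    have h3 : c + m ≠ 0 := by simpa using hcm m 0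
    have h4 : c - a - b + m ≠ 0 := by
      have := hδm m 0
      contrapose! this
      rw [Int.cast_zero, ← this]
      ring
    field_simp at h2 ⊢
    linear_combination h2
  have hprod : ∀ m : ℕ, s = (∏ j ∈ Finset.range m,
      (c - a + j) * (c - b + j) / ((c + j) * (c - a - b + j))) * S m := fun m => by
    induction m with
    | zero => simp [hS0]
    | succ m ih => rw [Finset.prod_range_succ, mul_assoc, ← hstep, ← ih]
  by_cases hpole : ∃ k : ℕ, c - a = -k ∨ c - b = -k
  · obtain ⟨k, hk⟩ := hpole
    have h1 : Complex.Gamma (c - a) * Complex.Gamma (c - b) = 0 := by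
      rcases hk with hk | hk <;> simp [hk, Complex.Gamma_neg_nat_eq_zero]
    rw [h1, div_zero, hprod (k + 1), Finset.prod_range_succ]
    rcases hk with hk | hk <;> simp [hk]
  · push Not at hpole
    have hS : Tendsto S atTop (𝓝 1) := by
      rw [tendsto_iff_norm_sub_tendsto_zero]
      set A := max ‖a‖ ‖b‖
      have h1 : Tendsto (fun m : ℕ => c.re + (m : ℝ)) atTop atTop :=
        tendsto_atTop_add_const_left _ _ tendsto_natCast_atTop_atTop
      have h2 : Tendsto (fun m : ℕ => 4 * A ^ 2 / (c.re + m) * ∑' n : ℕ, 1 / ((n : ℝ) + 2) ^ 2)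
          atTop (𝓝 0) := by
        have := (h1.const_div_atTop (4 * A ^ 2)).mul_const (∑' n : ℕ, 1 / ((n : ℝ) + 2) ^ 2)
        rwa [zero_mul] at this
      refine squeeze_zero' (.of_forall fun _ => norm_nonneg _) ?_ h2
      filter_upwards [h1.eventually_ge_atTop (4 * (A + 1) ^ 2),
        h1.eventually_gt_atTop (a.re + b.re)] with m hm1 hm2
      have h3 := (hST m).tendsto_one (hδm m) (by simp; linarith)
      refine le_of_tendsto (h3.sub_const 1).norm ?_
      filter_upwards [Ioo_mem_nhdsLT (zero_lt_one' ℝ)] with x hx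
      simpa using norm_ordinaryHypergeometric_sub_one_le (c := c + m) (le_max_left ‖a‖ ‖b‖)
        (le_max_right _ _) (by simpa using hm1) hx
    have h1 := ((Complex.GammaSeq_tendsto_Gamma c).mul
      (Complex.GammaSeq_tendsto_Gamma (c - a - b))).div
      ((Complex.GammaSeq_tendsto_Gamma (c - a)).mul (Complex.GammaSeq_tendsto_Gamma (c - b)))
      (mul_ne_zero (Complex.Gamma_ne_zero fun k => (hpole k).1)
        (Complex.Gamma_ne_zero fun k => (hpole k).2))
    have h2 := h1.mul (hS.comp (tendsto_add_atTop_nat 1))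
    rw [mul_one] at h2
    refine tendsto_nhds_unique (tendsto_const_nhds.congr' ?_) h2
    filter_upwards [eventually_ne_atTop 0] with m hm
    rw [hprod (m + 1), Function.comp_apply]
    congr 1
    have hm' : (m : ℂ) ≠ 0 := Nat.cast_ne_zero.2 hm
    have hf : (m.factorial : ℂ) ≠ 0 := Nat.cast_ne_zero.2 m.factorial_ne_zero
    have e : (m : ℂ) ^ (c - a - b) = (m : ℂ) ^ (c - a) * (m : ℂ) ^ (c - b) / (m : ℂ) ^ c := by
      rw [← Complex.cpow_add _ _ hm', ← Complex.cpow_sub _ _ hm']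
      ring_nf
    have x1 : (m : ℂ) ^ c ≠ 0 := by simp [Complex.cpow_eq_zero_iff, hm']
    have x2 : (m : ℂ) ^ (c - a) ≠ 0 := by simp [Complex.cpow_eq_zero_iff, hm']
    have x3 : (m : ℂ) ^ (c - b) ≠ 0 := by simp [Complex.cpow_eq_zero_iff, hm']
    simp only [Pi.div_apply, Complex.GammaSeq, Finset.prod_div_distrib, Finset.prod_mul_distrib, e]
    field_simp

/-- Euler's transformation, at the level of connection coefficients. For `0 < re c` the weighted
Wronskian of `₂F₁ a b c` and `(1 - z) ^ (c - a - b) * ₂F₁ (c - a) (c - b) c` vanishes at `0`, hence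
identically. -/
theorem fast_eq_slow (h : IsConnection a b c s t) (h' : IsConnection (c - a) (c - b) c s' t')
    (hc : ∀ k : ℕ, c ≠ -k) (hδ : ∀ k : ℤ, c - a - b ≠ k) (hre : 0 < c.re) : t = s' := by
  have hg := (IsGaussSolution.ordinaryHypergeometric (c - a) (c - b) hc).one_sub_cpow_mul
  have hy := IsGaussSolution.ordinaryHypergeometric a b hc
  have hc0 : c ≠ 0 := by simpa using hc 0
  have t1 := tendsto_zero_hypergeometric a b hc
  have t2 := tendsto_zero_hypergeometric (a + 1) (b + 1) (add_one_ne_neg_natCast hc)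
  have t3 := tendsto_zero_hypergeometric (c - a) (c - b) hc
  have t4 := tendsto_zero_hypergeometric (c - a + 1) (c - b + 1) (add_one_ne_neg_natCast hc)
  have t5 : Tendsto (fun z : ℝ => (1 - z : ℂ)) (𝓝[>] 0) (𝓝 1) := by
    have : ContinuousAt (fun z : ℝ => (1 - z : ℂ)) 0 := by fun_prop
    simpa using! this.tendsto.mono_left nhdsWithin_le_nhds
  have t6 : ∀ p : ℂ, Tendsto (fun z : ℝ => (1 - z : ℂ) ^ p) (𝓝[>] 0) (𝓝 1) := fun p => by
    have : ContinuousAt (fun z : ℝ => (1 - z : ℂ) ^ p) 0 :=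
      ContinuousAt.cpow (by fun_prop) continuousAt_const (by simp)
    simpa using! this.tendsto.mono_left nhdsWithin_le_nhds
  have t7 : Tendsto (fun z : ℝ => (z : ℂ) ^ c) (𝓝[>] 0) (𝓝 0) := by
    have h1 : Tendsto (fun z : ℝ => (z : ℂ)) (𝓝[>] 0) (𝓝 0) :=
      (Complex.continuous_ofReal.tendsto' 0 0 (by simp)).mono_left nhdsWithin_le_nhds
    have h := (Complex.continuousAt_cpow_zero_of_re_pos hre).tendsto.comp
      (h1.prodMk_nhds (tendsto_const_nhds (x := c)))
    simpa [Function.comp_def, Complex.zero_cpow hc0] using! h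
  obtain ⟨k, hk⟩ := hy.exists_wronskian_eq hg
  have t8 := (t7.mul (t6 (a + b - c + 1))).mul ((t1.mul ((t6 (c - a - b)).mul
    ((t4.const_mul ((c - a) * (c - b) / c)).sub ((t3.const_mul (c - a - b)).div t5 one_ne_zero)))).sub
    (((t6 (c - a - b)).mul t3).mul (t2.const_mul (a * b / c))))
  rw [zero_mul, zero_mul] at t8
  have hk0 : k = 0 := by
    refine tendsto_nhds_unique (tendsto_const_nhds.congr' ?_) t8
    filter_upwards [Ioo_mem_nhdsGT (zero_lt_one' ℝ)] with x hx
    exact (hk x hx).symm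
  -- the transformed solution in the Kummer basis
  have hg2 : ∀ z ∈ Ioo (0 : ℝ) 1, (1 - z : ℂ) ^ (c - a - b) * ₂F₁ (c - a) (c - b) c (z : ℂ) =
      t' * kummerSlow a b c z + s' * kummerFast a b c z := fun z hz => by
    have hz1 := one_sub_ofReal_ne_zero_of_mem_Ioo hz
    rw [h' z hz]
    have e1 : c - a + (c - b) - c + 1 = c - a - b + 1 := by ring
    have e2 : c - (c - a) = a := by ring
    have e3 : c - (c - b) = b := by ring
    have e4 : a - (c - b) + 1 = a + b - c + 1 := by ring
    have e5 : (1 - z : ℂ) ^ (c - a - b) * (1 - z : ℂ) ^ (a - (c - b)) = 1 := by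
      rw [← Complex.cpow_add _ _ hz1]
      ring_nf
      simp
    simp only [kummerSlow, kummerFast, e1, e2, e3, e4]
    linear_combination t' * ₂F₁ a b (a + b - c + 1) (1 - z : ℂ) * e5
  have hdet : s * s' - t * t' = 0 := by
    have hz : (1 / 2 : ℝ) ∈ Ioo (0 : ℝ) 1 := by norm_num
    have hW := wronskian_kummer_ne_zero hδ hz
    have d2 := (((isGaussSolution_kummerSlow hδ).hasDerivAt _ hz).const_mul t').add
      (((isGaussSolution_kummerFast hδ).hasDerivAt _ hz).const_mul s')
    have d3 := (hg.hasDerivAt _ hz).unique (d2.congr_of_eventuallyEq (by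
      filter_upwards [Ioo_mem_nhds hz.1 hz.2] with x hx using hg2 x hx))
    have h1 := hk _ hz
    rw [d3, hg2 _ hz, h _ hz, h.deriv_eq hc hδ hz, hk0, mul_eq_zero] at h1
    have h2 := h1.resolve_left (cpow_mul_one_sub_cpow_ne_zero _ _ hz)
    refine (mul_eq_zero.1 ?_).resolve_right hW
    linear_combination h2
  have t9 := (t1.const_mul s').sub (((t6 (c - a - b)).mul t3).const_mul t)
  have t10 : s' * 1 - t * (1 * 1) = 0 := by
    refine tendsto_nhds_unique t9 (tendsto_const_nhds.congr' ?_)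
    filter_upwards [Ioo_mem_nhdsGT (zero_lt_one' ℝ)] with x hx
    rw [hg2 x hx, h x hx]
    linear_combination -kummerSlow a b c x * hdet
  linear_combination -t10

theorem fast_eq (h : IsConnection a b c s t) (hc : ∀ k : ℕ, c ≠ -k)
    (hδ : ∀ k : ℤ, c - a - b ≠ k) :
    t = Complex.Gamma c * Complex.Gamma (a + b - c) / (Complex.Gamma a * Complex.Gamma b) := by
  obtain ⟨n, hn⟩ := exists_nat_gt (-c.re)
  induction n generalizing a b c s t with
  | zero =>
    have hre : 0 < c.re := by simpa using hn
    have hδ' : ∀ k : ℤ, c - (c - a) - (c - b) ≠ k := fun k hk => hδ (-k) (by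
      push_cast; linear_combination -hk)
    obtain ⟨s', t', h'⟩ := exists_isConnection (a := c - a) (b := c - b) hc hδ'
    rw [h.fast_eq_slow h' hc hδ hre, h'.slow_eq hc hδ']
    ring_nf
  | succ n ih =>
    have hc1 := add_one_ne_neg_natCast hc
    have hδ' : ∀ k : ℤ, c + 1 - (a + 1) - (b + 1) ≠ k := fun k hk => hδ (k + 1) (by
      push_cast; linear_combination hk)
    obtain ⟨s', t', h'⟩ := exists_isConnection hc1 hδ'
    have h1 := ih h' hc1 hδ' (by simp at hn ⊢; linarith)
    have h2 := h.fast_shift h' hc hδ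
    have hc0 : c ≠ 0 := by simpa using hc 0
    have hδ0 : c - a - b ≠ 0 := by simpa using hδ 0
    have hδ1 : a + b - c ≠ 0 := fun h0 => hδ0 (by linear_combination -h0)
    have h3 : t = a * b / (c * (a + b - c)) * t' := by
      field_simp at h2 ⊢
      linear_combination h2
    have e : a + 1 + (b + 1) - (c + 1) = a + b - c + 1 := by ring
    rw [h3, h1, e, Complex.Gamma_add_one _ hc0, Complex.Gamma_add_one _ hδ1]
    by_cases ha : a = 0
    · simp [ha]
    by_cases hb : b = 0
    · simp [hb]
    rw [Complex.Gamma_add_one _ ha, Complex.Gamma_add_one _ hb]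
    field_simp

end IsConnection

/-- The connection formula between `z = 0` and `z = 1`. -/
theorem ordinaryHypergeometric_connection {a b c : ℂ} (hc : ∀ k : ℕ, c ≠ -k)
    (hδ : ∀ k : ℤ, c - a - b ≠ k) :
    IsConnection a b c
      (Complex.Gamma c * Complex.Gamma (c - a - b) /
        (Complex.Gamma (c - a) * Complex.Gamma (c - b)))
      (Complex.Gamma c * Complex.Gamma (a + b - c) / (Complex.Gamma a * Complex.Gamma b)) := by
  obtain ⟨s, t, h⟩ := exists_isConnection hc hδ
  rwa [← h.slow_eq hc hδ, ← h.fast_eq hc hδ]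

noncomputable section

/-! ### The prefactor `z ^ ρ₀ * (1 - z) ^ ρ₁` and the radial equation -/

/-- The factor `z ^ ρ₀ * (1 - z) ^ ρ₁` that carries the local exponents. -/
def exponentFactor (ρ₀ ρ₁ : ℂ) (z : ℝ) : ℂ := (z : ℂ) ^ ρ₀ * (1 - z : ℂ) ^ ρ₁

/-- The logarithmic derivative of `exponentFactor`. -/
def exponentLogDeriv (ρ₀ ρ₁ : ℂ) (z : ℝ) : ℂ := ρ₀ / z - ρ₁ / (1 - z)

theorem exponentFactor_ne_zero (ρ₀ ρ₁ : ℂ) {z : ℝ} (hz : z ∈ Ioo (0 : ℝ) 1) :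
    exponentFactor ρ₀ ρ₁ z ≠ 0 :=
  cpow_mul_one_sub_cpow_ne_zero ρ₀ ρ₁ hz

theorem hasDerivAt_exponentFactor (ρ₀ ρ₁ : ℂ) {z : ℝ} (hz : z ∈ Ioo (0 : ℝ) 1) :
    HasDerivAt (exponentFactor ρ₀ ρ₁) (exponentFactor ρ₀ ρ₁ z * exponentLogDeriv ρ₀ ρ₁ z) z := by
  convert! (hasDerivAt_ofReal_cpow_div ρ₀ hz).mul (hasDerivAt_one_sub_ofReal_cpow ρ₁ hz) using 1
  simp only [exponentFactor, exponentLogDeriv]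
  ring

theorem hasDerivAt_exponentLogDeriv (ρ₀ ρ₁ : ℂ) {z : ℝ} (hz : z ∈ Ioo (0 : ℝ) 1) :
    HasDerivAt (exponentLogDeriv ρ₀ ρ₁) (-ρ₀ / z ^ 2 - ρ₁ / (1 - z) ^ 2) z := by
  have h0 := ofReal_ne_zero_of_mem_Ioo hz
  have h1 := one_sub_ofReal_ne_zero_of_mem_Ioo hz
  have h2 : HasDerivAt (fun x : ℝ => (x : ℂ)) 1 z := (hasDerivAt_id (z : ℂ)).comp_ofReal
  convert! (((hasDerivAt_const z ρ₀).div h2 h0)).sub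
    ((hasDerivAt_const z ρ₁).div (h2.const_sub 1) h1) using 1
  ring

theorem exponentFactor_eq_exp (ρ₀ ρ₁ : ℂ) {z : ℝ} (hz : z ∈ Ioo (0 : ℝ) 1) :
    exponentFactor ρ₀ ρ₁ z =
      Complex.exp (ρ₀ * (Real.log z : ℂ) + ρ₁ * (Real.log (1 - z) : ℂ)) := by
  rw [exponentFactor, Complex.cpow_def_of_ne_zero (ofReal_ne_zero_of_mem_Ioo hz),
    Complex.cpow_def_of_ne_zero (one_sub_ofReal_ne_zero_of_mem_Ioo hz), ← Complex.exp_add,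
    Complex.ofReal_log hz.1.le, Complex.ofReal_log (one_sub_mem_Ioo hz).1.le]
  push_cast
  ring_nf

namespace IsGaussSolution

variable {a b c : ℂ} {u u' v v' : ℝ → ℂ}

theorem deriv_eqOn (h : IsGaussSolution a b c u u') : EqOn (deriv u) u' (Ioo 0 1) :=
  fun z hz => (h.hasDerivAt z hz).deriv

theorem deriv_deriv (h : IsGaussSolution a b c u u') {z : ℝ} (hz : z ∈ Ioo (0 : ℝ) 1) :
    deriv (deriv u) z = (a * b * u z - (c - (a + b + 1) * z) * u' z) / (z * (1 - z)) := by
  rw [(h.deriv_eqOn.eventuallyEq_of_mem (Ioo_mem_nhds hz.1 hz.2)).deriv_eq,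
    (h.hasDerivAt_deriv z hz).deriv]

theorem solvesGauss (h : IsGaussSolution a b c u u') : SolvesGauss a b c u := fun z hz => by
  have h0 := ofReal_ne_zero_of_mem_Ioo hz
  have h1 := one_sub_ofReal_ne_zero_of_mem_Ioo hz
  rw [h.deriv_deriv hz, h.deriv_eqOn hz]
  field_simp
  ring

theorem contDiffOn (h : IsGaussSolution a b c u u') : ContDiffOn ℝ 2 u (Ioo 0 1) := by
  have hu : DifferentiableOn ℝ u (Ioo 0 1) := fun z hz =>
    (h.hasDerivAt z hz).differentiableAt.differentiableWithinAt
  have hu' : DifferentiableOn ℝ u' (Ioo 0 1) := fun z hz =>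
    (h.hasDerivAt_deriv z hz).differentiableAt.differentiableWithinAt
  rw [← one_add_one_eq_two, contDiffOn_succ_iff_deriv_of_isOpen isOpen_Ioo]
  refine ⟨hu, by simp, ?_⟩
  refine ContDiffOn.congr ?_ h.deriv_eqOn
  rw [← zero_add 1, contDiffOn_succ_iff_deriv_of_isOpen isOpen_Ioo]
  refine ⟨hu', by simp, contDiffOn_zero.2 ?_⟩
  refine ContinuousOn.congr (f := fun z : ℝ =>
    (a * b * u z - (c - (a + b + 1) * z) * u' z) / (z * (1 - z))) ?_
    fun z hz => (h.hasDerivAt_deriv z hz).deriv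
  have hz : ContinuousOn (fun z : ℝ => (z : ℂ)) (Ioo 0 1) := Complex.continuous_ofReal.continuousOn
  refine ((continuousOn_const.mul hu.continuousOn).sub ((continuousOn_const.sub
    (continuousOn_const.mul hz)).mul hu'.continuousOn)).div (hz.mul (continuousOn_const.sub hz)) ?_
  exact fun z hz => mul_ne_zero (ofReal_ne_zero_of_mem_Ioo hz)
    (one_sub_ofReal_ne_zero_of_mem_Ioo hz)

theorem hasDerivAt_exponentFactor_mul (h : IsGaussSolution a b c u u') (ρ₀ ρ₁ : ℂ) {z : ℝ}
    (hz : z ∈ Ioo (0 : ℝ) 1) :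
    HasDerivAt (fun x => exponentFactor ρ₀ ρ₁ x * u x)
      (exponentFactor ρ₀ ρ₁ z * (exponentLogDeriv ρ₀ ρ₁ z * u z + u' z)) z := by
  convert! (hasDerivAt_exponentFactor ρ₀ ρ₁ hz).mul (h.hasDerivAt z hz) using 1
  ring

theorem deriv_deriv_exponentFactor_mul (h : IsGaussSolution a b c u u') (ρ₀ ρ₁ : ℂ) {z : ℝ}
    (hz : z ∈ Ioo (0 : ℝ) 1) :
    deriv (deriv (fun x => exponentFactor ρ₀ ρ₁ x * u x)) z =
      exponentFactor ρ₀ ρ₁ z *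
        ((exponentLogDeriv ρ₀ ρ₁ z ^ 2 + (-ρ₀ / z ^ 2 - ρ₁ / (1 - z) ^ 2)) * u z +
          2 * exponentLogDeriv ρ₀ ρ₁ z * u' z +
          (a * b * u z - (c - (a + b + 1) * z) * u' z) / (z * (1 - z))) := by
  have e : deriv (fun x => exponentFactor ρ₀ ρ₁ x * u x) =ᶠ[𝓝 z] fun x =>
      exponentFactor ρ₀ ρ₁ x * (exponentLogDeriv ρ₀ ρ₁ x * u x + u' x) := by
    filter_upwards [Ioo_mem_nhds hz.1 hz.2] with x hx using
      (h.hasDerivAt_exponentFactor_mul ρ₀ ρ₁ hx).deriv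
  rw [e.deriv_eq]
  refine HasDerivAt.deriv ?_
  convert! (hasDerivAt_exponentFactor ρ₀ ρ₁ hz).mul
    (((hasDerivAt_exponentLogDeriv ρ₀ ρ₁ hz).mul (h.hasDerivAt z hz)).add
      (h.hasDerivAt_deriv z hz)) using 1
  simp only [Pi.add_apply, Pi.mul_apply]
  ring

theorem wronskian_exponentFactor_mul (hu : IsGaussSolution a b c u u')
    (hv : IsGaussSolution a b c v v') (ρ₀ ρ₁ : ℂ) {z : ℝ} (hz : z ∈ Ioo (0 : ℝ) 1) :
    wronskian (fun x => exponentFactor ρ₀ ρ₁ x * u x) (fun x => exponentFactor ρ₀ ρ₁ x * v x) z =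
      exponentFactor ρ₀ ρ₁ z ^ 2 * (u z * v' z - v z * u' z) := by
  rw [wronskian, (hu.hasDerivAt_exponentFactor_mul ρ₀ ρ₁ hz).deriv,
    (hv.hasDerivAt_exponentFactor_mul ρ₀ ρ₁ hz).deriv]
  ring

end IsGaussSolution

/-- Two independent solutions determine the first-order coefficient of the radial equation. -/
theorem HypData.ReducesToGauss.coeff_eq {d : HypData} {P Q : ℝ → ℂ → ℂ} {ω : ℂ}
    (h : d.ReducesToGauss P Q ω) (hδ : ∀ k : ℤ, d.c ω - d.a ω - d.b ω ≠ k) {z : ℝ}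
    (hz : z ∈ Ioo (0 : ℝ) 1) :
    P z ω = d.c ω / z - (d.a ω + d.b ω - d.c ω + 1) / (1 - z) -
      2 * exponentLogDeriv (d.ρ₀ ω) (d.ρ₁ ω) z := by
  have hs := isGaussSolution_kummerSlow hδ
  have hf := isGaussSolution_kummerFast hδ
  have r1 := (h _ hs.contDiffOn).2 hs.solvesGauss z hz
  have r2 := (h _ hf.contDiffOn).2 hf.solvesGauss z hz
  simp only [← exponentFactor.eq_1] at r1 r2
  rw [hs.deriv_deriv_exponentFactor_mul _ _ hz,
    (hs.hasDerivAt_exponentFactor_mul _ _ hz).deriv] at r1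
  rw [hf.deriv_deriv_exponentFactor_mul _ _ hz,
    (hf.hasDerivAt_exponentFactor_mul _ _ hz).deriv] at r2
  have hW := wronskian_kummer_ne_zero hδ hz
  have hA := exponentFactor_ne_zero (d.ρ₀ ω) (d.ρ₁ ω) hz
  have h0 := ofReal_ne_zero_of_mem_Ioo hz
  have h1 := one_sub_ofReal_ne_zero_of_mem_Ioo hz
  refine sub_eq_zero.1 ((mul_eq_zero.1 ?_).resolve_right (mul_ne_zero hA hW))
  have e : d.c ω / z - (d.a ω + d.b ω - d.c ω + 1) / (1 - z) =
      (d.c ω - (d.a ω + d.b ω + 1) * z) / (z * (1 - z)) := by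
    field_simp
    ring
  rw [e]
  generalize kummerSlow (d.a ω) (d.b ω) (d.c ω) z = s at *
  generalize kummerSlowDeriv (d.a ω) (d.b ω) (d.c ω) z = s' at *
  generalize kummerFast (d.a ω) (d.b ω) (d.c ω) z = f at *
  generalize kummerFastDeriv (d.a ω) (d.b ω) (d.c ω) z = f' at *
  generalize -d.ρ₀ ω / (z : ℂ) ^ 2 - d.ρ₁ ω / (1 - z) ^ 2 = L' at *
  linear_combination s * r2 - f * r1

/-- The radial equation ties the integrating factor to the local exponents: this combination does
not depend on `z`. It is what makes ratios of `exponentFactor` analytic in the frequency, although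
`ρ₀` and `ρ₁` are not assumed to be analytic. -/
theorem HypData.ReducesToGauss.primitive_eq {d : HypData} {P Q p : ℝ → ℂ → ℂ} {ω : ℂ}
    (h : d.ReducesToGauss P Q ω) (hδ : ∀ k : ℤ, d.c ω - d.a ω - d.b ω ≠ k)
    (hp : ∀ z ∈ Ioo (0 : ℝ) 1, HasDerivAt (fun x => p x ω) (P z ω) z) :
    ∃ k : ℂ, ∀ z ∈ Ioo (0 : ℝ) 1, p z ω + 2 * (d.ρ₀ ω * (Real.log z : ℂ) +
      d.ρ₁ ω * (Real.log (1 - z) : ℂ)) - (d.c ω * (Real.log z : ℂ) +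
      (d.a ω + d.b ω - d.c ω + 1) * (Real.log (1 - z) : ℂ)) = k := by
  have hd : ∀ z ∈ Ioo (0 : ℝ) 1, HasDerivAt (fun z : ℝ => p z ω +
      2 * (d.ρ₀ ω * (Real.log z : ℂ) + d.ρ₁ ω * (Real.log (1 - z) : ℂ)) -
      (d.c ω * (Real.log z : ℂ) +
        (d.a ω + d.b ω - d.c ω + 1) * (Real.log (1 - z) : ℂ))) 0 z := fun z hz => by
    have l1 : HasDerivAt (fun x : ℝ => (Real.log x : ℂ)) (z : ℂ)⁻¹ z := by
      exact_mod_cast (Real.hasDerivAt_log hz.1.ne').ofReal_comp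
    have l2 : HasDerivAt (fun x : ℝ => (Real.log (1 - x) : ℂ)) (-1 / (1 - z)) z := by
      exact_mod_cast (((hasDerivAt_id z).const_sub 1).log (one_sub_mem_Ioo hz).1.ne').ofReal_comp
    convert! ((hp z hz).add (((l1.const_mul (d.ρ₀ ω)).add (l2.const_mul (d.ρ₁ ω))).const_mul 2)).sub
      ((l1.const_mul (d.c ω)).add (l2.const_mul (d.a ω + d.b ω - d.c ω + 1))) using 1
    rw [h.coeff_eq hδ hz, exponentLogDeriv]
    ring
  exact isOpen_Ioo.exists_is_const_of_deriv_eq_zero isPreconnected_Ioo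
    (fun z hz => (hd z hz).differentiableAt.differentiableWithinAt) fun z hz => (hd z hz).deriv

/-! ### Simple poles -/

theorem hasSimplePolePart_div {N f : ℂ → ℂ} {ω₀ : ℂ} (hN : AnalyticAt ℂ N ω₀)
    (hf : AnalyticAt ℂ f ω₀) (h0 : f ω₀ = 0) (h1 : deriv f ω₀ ≠ 0) :
    HasSimplePolePart (fun ω => N ω / f ω) ω₀ (N ω₀ / deriv f ω₀) := by
  obtain ⟨q, hq⟩ := hf
  have hf1 : AnalyticAt ℂ (dslope f ω₀) ω₀ := ⟨_, hq.has_fpower_series_dslope_fslope⟩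
  have hH : AnalyticAt ℂ (fun ω => N ω / dslope f ω₀ ω) ω₀ := hN.div hf1 (by rwa [dslope_same])
  obtain ⟨q', hq'⟩ := hH
  refine ⟨_, ⟨_, hq'.has_fpower_series_dslope_fslope⟩, ?_⟩
  filter_upwards [self_mem_nhdsWithin] with ω hω
  have hω' : ω - ω₀ ≠ 0 := sub_ne_zero.2 hω
  have e1 := sub_smul_dslope f ω₀ ω
  have e2 := sub_smul_dslope (fun ω => N ω / dslope f ω₀ ω) ω₀ ω
  rw [h0, sub_zero, smul_eq_mul] at e1
  rw [smul_eq_mul, dslope_same] at e2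
  have e3 : N ω / dslope f ω₀ ω = N ω₀ / deriv f ω₀ +
      (ω - ω₀) * dslope (fun ω => N ω / dslope f ω₀ ω) ω₀ ω := by linear_combination -e2
  rw [← e1, mul_comm, ← div_div, e3, add_div, mul_div_cancel_left₀ _ hω']

theorem HasSimplePolePart.congr {f g : ℂ → ℂ} {ω₀ r : ℂ} (hf : HasSimplePolePart f ω₀ r)
    (h : f =ᶠ[𝓝[≠] ω₀] g) : HasSimplePolePart g ω₀ r := by
  obtain ⟨k, hk, he⟩ := hf
  exact ⟨k, hk, by filter_upwards [he, h] with ω h1 h2 using h2 ▸ h1⟩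

theorem HasSimplePolePart.meromorphicOrderAt_eq_neg_one_iff {f : ℂ → ℂ} {ω₀ r : ℂ}
    (hf : HasSimplePolePart f ω₀ r) : meromorphicOrderAt f ω₀ = -1 ↔ r ≠ 0 := by
  obtain ⟨g, hg, he⟩ := hf
  constructor
  · rintro h rfl
    have h1 : f =ᶠ[𝓝[≠] ω₀] g := by
      filter_upwards [he] with ω hω
      simpa using hω
    rw [meromorphicOrderAt_congr h1] at h
    have h2 := hg.meromorphicOrderAt_nonneg
    rw [h] at h2
    exact absurd h2 (by decide)
  · intro hr
    have h1 : f =ᶠ[𝓝[≠] ω₀] fun ω => (ω - ω₀) ^ (-1 : ℤ) • (r + (ω - ω₀) * g ω) := by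
      filter_upwards [he, self_mem_nhdsWithin] with ω hω hne
      have hω' : ω - ω₀ ≠ 0 := sub_ne_zero.2 hne
      rw [hω, zpow_neg_one, smul_eq_mul]
      field_simp
    have h2 : AnalyticAt ℂ (fun ω => r + (ω - ω₀) * g ω) ω₀ := by fun_prop
    have h3 : MeromorphicAt f ω₀ := by
      refine MeromorphicAt.congr ?_ h1.symm
      fun_prop
    exact (meromorphicOrderAt_eq_int_iff h3).2 ⟨_, h2, by simpa using hr, h1⟩

/-! ### Dependence on the frequency -/

theorem analyticAt_inv_gamma {f : ℂ → ℂ} {ω₀ : ℂ} (hf : AnalyticAt ℂ f ω₀) :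
    AnalyticAt ℂ (fun ω => (Complex.Gamma (f ω))⁻¹) ω₀ :=
  (Complex.differentiable_one_div_Gamma.analyticAt _).comp hf

theorem analyticAt_gamma {f : ℂ → ℂ} {ω₀ : ℂ} (hf : AnalyticAt ℂ f ω₀)
    (h : ∀ k : ℕ, f ω₀ ≠ -k) : AnalyticAt ℂ (fun ω => Complex.Gamma (f ω)) ω₀ := by
  have h1 := (analyticAt_inv_gamma hf).inv (inv_ne_zero (Complex.Gamma_ne_zero h))
  exact h1.congr (.of_forall fun ω => by simp)

section Analytic

variable {a b c : ℂ → ℂ} {ω₀ : ℂ} {z : ℝ}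

theorem analyticAt_one_sub_cpow (hc : AnalyticAt ℂ c ω₀) (hz : z ∈ Ioo (0 : ℝ) 1) :
    AnalyticAt ℂ (fun ω => (1 - z : ℂ) ^ c ω) ω₀ := by
  simp_rw [Complex.cpow_def_of_ne_zero (one_sub_ofReal_ne_zero_of_mem_Ioo hz)]
  fun_prop

theorem analyticAt_kummerSlow (ha : AnalyticAt ℂ a ω₀) (hb : AnalyticAt ℂ b ω₀)
    (hc : AnalyticAt ℂ c ω₀) (hδ : ∀ k : ℤ, c ω₀ - a ω₀ - b ω₀ ≠ k) (hz : z ∈ Ioo (0 : ℝ) 1) :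
    AnalyticAt ℂ (fun ω => kummerSlow (a ω) (b ω) (c ω) z) ω₀ :=
  analyticAt_ordinaryHypergeometric_param ha hb (by fun_prop) (slow_parameter_ne hδ)
    (norm_one_sub_ofReal_lt_one hz)

theorem analyticAt_kummerSlowDeriv (ha : AnalyticAt ℂ a ω₀) (hb : AnalyticAt ℂ b ω₀)
    (hc : AnalyticAt ℂ c ω₀) (hδ : ∀ k : ℤ, c ω₀ - a ω₀ - b ω₀ ≠ k) (hz : z ∈ Ioo (0 : ℝ) 1) :
    AnalyticAt ℂ (fun ω => kummerSlowDeriv (a ω) (b ω) (c ω) z) ω₀ := by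
  have h0 : a ω₀ + b ω₀ - c ω₀ + 1 ≠ 0 := by simpa using slow_parameter_ne hδ 0
  exact (((ha.mul hb).div (by fun_prop) h0).mul (analyticAt_ordinaryHypergeometric_param
    (by fun_prop) (by fun_prop) (by fun_prop) (add_one_ne_neg_natCast (slow_parameter_ne hδ))
    (norm_one_sub_ofReal_lt_one hz))).neg

theorem analyticAt_kummerFast (ha : AnalyticAt ℂ a ω₀) (hb : AnalyticAt ℂ b ω₀)
    (hc : AnalyticAt ℂ c ω₀) (hδ : ∀ k : ℤ, c ω₀ - a ω₀ - b ω₀ ≠ k) (hz : z ∈ Ioo (0 : ℝ) 1) :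
    AnalyticAt ℂ (fun ω => kummerFast (a ω) (b ω) (c ω) z) ω₀ :=
  (analyticAt_one_sub_cpow (by fun_prop) hz).mul (analyticAt_ordinaryHypergeometric_param
    (by fun_prop) (by fun_prop) (by fun_prop) (fast_parameter_ne hδ)
    (norm_one_sub_ofReal_lt_one hz))

theorem analyticAt_kummerFastDeriv (ha : AnalyticAt ℂ a ω₀) (hb : AnalyticAt ℂ b ω₀)
    (hc : AnalyticAt ℂ c ω₀) (hδ : ∀ k : ℤ, c ω₀ - a ω₀ - b ω₀ ≠ k) (hz : z ∈ Ioo (0 : ℝ) 1) :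
    AnalyticAt ℂ (fun ω => kummerFastDeriv (a ω) (b ω) (c ω) z) ω₀ := by
  have h0 : c ω₀ - a ω₀ - b ω₀ + 1 ≠ 0 := by simpa using fast_parameter_ne hδ 0
  have h1 := analyticAt_ordinaryHypergeometric_param (a := fun ω => c ω - a ω)
    (b := fun ω => c ω - b ω) (c := fun ω => c ω - a ω - b ω + 1)
    (by fun_prop) (by fun_prop) (by fun_prop) (fast_parameter_ne hδ)
    (norm_one_sub_ofReal_lt_one hz)
  have h2 := analyticAt_ordinaryHypergeometric_param (a := fun ω => c ω - a ω + 1)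
    (b := fun ω => c ω - b ω + 1) (c := fun ω => c ω - a ω - b ω + 1 + 1)
    (by fun_prop) (by fun_prop) (by fun_prop) (add_one_ne_neg_natCast (fast_parameter_ne hδ))
    (norm_one_sub_ofReal_lt_one hz)
  have h3 : AnalyticAt ℂ (fun ω => (c ω - a ω) * (c ω - b ω) / (c ω - a ω - b ω + 1)) ω₀ :=
    AnalyticAt.div (by fun_prop) (by fun_prop) h0
  exact (analyticAt_one_sub_cpow (by fun_prop) hz).mul ((h3.mul h2).neg.sub
    ((((hc.sub ha).sub hb).mul h1).div analyticAt_const (one_sub_ofReal_ne_zero_of_mem_Ioo hz)))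

end Analytic

/-- The zeros of `₂F₁ a b c` in `(0,1)` are isolated. -/
theorem eventually_ordinaryHypergeometric_ne_zero (a b : ℂ) {c : ℂ} (hc : ∀ k : ℕ, c ≠ -k)
    {x : ℝ} (hx : x ∈ Ioo (0 : ℝ) 1) : ∀ᶠ z : ℝ in 𝓝[≠] x, ₂F₁ a b c (z : ℂ) ≠ 0 := by
  have h1 : AnalyticOnNhd ℂ (₂F₁ a b c) (Metric.ball (0 : ℂ) 1) :=
    DifferentiableOn.analyticOnNhd (fun w hw => (hasDerivAt_ordinaryHypergeometric a b hc
      (mem_ball_zero_iff.1 hw)).differentiableAt.differentiableWithinAt) Metric.isOpen_ball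
  have h2 : ∀ᶠ w : ℂ in 𝓝[≠] (x : ℂ), ₂F₁ a b c w ≠ 0 := by
    by_contra h
    rw [Filter.not_eventually] at h
    have h3 := h1.eqOn_zero_of_preconnected_of_frequently_eq_zero
      (convex_ball (0 : ℂ) 1).isPreconnected (mem_ball_zero_iff.2 (norm_ofReal_lt_one hx))
      (by simpa using h)
    simpa using h3 (Metric.mem_ball_self one_pos)
  have h4 : Tendsto (fun z : ℝ => (z : ℂ)) (𝓝[≠] x) (𝓝[≠] (x : ℂ)) :=
    tendsto_nhdsWithin_of_tendsto_nhds_of_eventually_within _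
      (Complex.continuous_ofReal.continuousAt.tendsto.mono_left nhdsWithin_le_nhds)
      (by filter_upwards [self_mem_nhdsWithin] with z hz using by simpa using hz)
  exact h4.eventually h2

end

/-! ### The spectral problem -/

namespace HypData

variable (d : HypData) {ω : ℂ} {z : ℝ}

theorem Rin_eq (z : ℝ) (ω : ℂ) : d.Rin z ω =
    exponentFactor (d.ρ₀ ω) (d.ρ₁ ω) z * ₂F₁ (d.a ω) (d.b ω) (d.c ω) (z : ℂ) :=
  rfl

theorem Rslow_eq (z : ℝ) (ω : ℂ) : d.Rslow z ω =
    exponentFactor (d.ρ₀ ω) (d.ρ₁ ω) z * kummerSlow (d.a ω) (d.b ω) (d.c ω) z :=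
  rfl

theorem Rfast_eq (hz : z ∈ Ioo (0 : ℝ) 1) : d.Rfast z ω =
    exponentFactor (d.ρ₀ ω) (d.ρ₁ ω) z * kummerFast (d.a ω) (d.b ω) (d.c ω) z := by
  have e : d.ρ₁ ω + d.c ω - d.a ω - d.b ω = d.ρ₁ ω + (d.c ω - d.a ω - d.b ω) := by ring
  rw [Rfast, exponentFactor, kummerFast, e,
    Complex.cpow_add _ _ (one_sub_ofReal_ne_zero_of_mem_Ioo hz)]
  ring

theorem Rin_eq_add (hc : ∀ k : ℕ, d.c ω ≠ -k) (hδ : ∀ k : ℤ, d.c ω - d.a ω - d.b ω ≠ k)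
    (hz : z ∈ Ioo (0 : ℝ) 1) :
    d.Rin z ω = d.Cslow ω * d.Rslow z ω + d.Cfast ω * d.Rfast z ω := by
  rw [Rin_eq, Rslow_eq, d.Rfast_eq hz, ordinaryHypergeometric_connection hc hδ z hz, Cslow, Cfast]
  ring

theorem differentiableAt_Rslow (hδ : ∀ k : ℤ, d.c ω - d.a ω - d.b ω ≠ k) (hz : z ∈ Ioo (0 : ℝ) 1) :
    DifferentiableAt ℝ (fun x => d.Rslow x ω) z :=
  ((isGaussSolution_kummerSlow hδ).hasDerivAt_exponentFactor_mul _ _ hz).differentiableAt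

theorem Rfast_eventuallyEq (hz : z ∈ Ioo (0 : ℝ) 1) : (fun x => d.Rfast x ω) =ᶠ[𝓝 z]
    fun x => exponentFactor (d.ρ₀ ω) (d.ρ₁ ω) x * kummerFast (d.a ω) (d.b ω) (d.c ω) x := by
  filter_upwards [Ioo_mem_nhds hz.1 hz.2] with x hx using d.Rfast_eq hx

theorem differentiableAt_Rfast (hδ : ∀ k : ℤ, d.c ω - d.a ω - d.b ω ≠ k) (hz : z ∈ Ioo (0 : ℝ) 1) :
    DifferentiableAt ℝ (fun x => d.Rfast x ω) z :=
  (((isGaussSolution_kummerFast hδ).hasDerivAt_exponentFactor_mul _ _ hz).congr_of_eventuallyEq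
    (d.Rfast_eventuallyEq hz)).differentiableAt

theorem Wsf_eq (hδ : ∀ k : ℤ, d.c ω - d.a ω - d.b ω ≠ k) (hz : z ∈ Ioo (0 : ℝ) 1) :
    d.Wsf z ω = exponentFactor (d.ρ₀ ω) (d.ρ₁ ω) z ^ 2 *
      (kummerSlow (d.a ω) (d.b ω) (d.c ω) z * kummerFastDeriv (d.a ω) (d.b ω) (d.c ω) z -
        kummerFast (d.a ω) (d.b ω) (d.c ω) z * kummerSlowDeriv (d.a ω) (d.b ω) (d.c ω) z) := by
  rw [← (isGaussSolution_kummerSlow hδ).wronskian_exponentFactor_mul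
    (isGaussSolution_kummerFast hδ) _ _ hz, Wsf, wronskian, wronskian,
    (d.Rfast_eventuallyEq hz).deriv_eq, d.Rfast_eq hz]
  rfl

/-- The Wronskian of the ingoing and the outer solution vanishes exactly with the quantization
function. -/
theorem wronskian_Rin_RB (hc : ∀ k : ℕ, d.c ω ≠ -k) (hδ : ∀ k : ℤ, d.c ω - d.a ω - d.b ω ≠ k)
    (α β : ℂ) (hz : z ∈ Ioo (0 : ℝ) 1) :
    wronskian (fun x => d.Rin x ω) (fun x => d.RB α β x ω) z = -(d.F α β ω * d.Wsf z ω) := by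
  have hs := (d.differentiableAt_Rslow hδ hz).hasDerivAt
  have hf := (d.differentiableAt_Rfast hδ hz).hasDerivAt
  have h1 := ((hs.const_mul (d.Cslow ω)).add (hf.const_mul (d.Cfast ω))).congr_of_eventuallyEq
    (f₁ := fun x => d.Rin x ω) (by
      filter_upwards [Ioo_mem_nhds hz.1 hz.2] with x hx using d.Rin_eq_add hc hδ hx)
  have h2 : HasDerivAt (fun x => d.RB α β x ω) _ z := (hs.const_mul β).sub (hf.const_mul α)
  rw [wronskian, h1.deriv, h2.deriv, d.Rin_eq_add hc hδ hz, F, Wsf, wronskian, RB]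
  ring

theorem weighted_Wsf_eq {P Q p : ℝ → ℂ → ℂ} (h : d.ReducesToGauss P Q ω)
    (hδ : ∀ k : ℤ, d.c ω - d.a ω - d.b ω ≠ k)
    (hp : ∀ z ∈ Ioo (0 : ℝ) 1, HasDerivAt (fun x => p x ω) (P z ω) z) :
    ∃ k : ℂ, ∀ z ∈ Ioo (0 : ℝ) 1, Complex.exp (p z ω) * d.Wsf z ω = k := by
  obtain ⟨k, hk⟩ := h.primitive_eq hδ hp
  obtain ⟨l, hl⟩ := (isGaussSolution_kummerSlow hδ).exists_wronskian_eq
    (isGaussSolution_kummerFast hδ)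
  refine ⟨Complex.exp k * l, fun z hz => ?_⟩
  have e := exponentFactor_eq_exp (d.c ω) (d.a ω + d.b ω - d.c ω + 1) hz
  rw [exponentFactor] at e
  rw [d.Wsf_eq hδ hz, ← hl z hz, e, ← hk z hz, exponentFactor_eq_exp _ _ hz, ← Complex.exp_nat_mul,
    ← mul_assoc, ← mul_assoc, ← Complex.exp_add, ← Complex.exp_add]
  congr 2
  push_cast
  ring

/-- Ratios of the prefactor are analytic in the frequency. -/
theorem analyticAt_exponentFactor_div {P Q p : ℝ → ℂ → ℂ} {U : Set ℂ} {ω₀ : ℂ} (hU : IsOpen U)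
    (hω₀ : ω₀ ∈ U) (hred : ∀ ω ∈ U, d.ReducesToGauss P Q ω)
    (hp : ∀ ω ∈ U, ∀ z ∈ Ioo (0 : ℝ) 1, HasDerivAt (fun x => p x ω) (P z ω) z)
    (hpω : ∀ z ∈ Ioo (0 : ℝ) 1, AnalyticOnNhd ℂ (p z) U)
    (ha : AnalyticAt ℂ d.a ω₀) (hb : AnalyticAt ℂ d.b ω₀) (hc : AnalyticAt ℂ d.c ω₀)
    (hδ : ∀ ω ∈ U, ∀ k : ℤ, d.c ω - d.a ω - d.b ω ≠ k) {z z' : ℝ}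
    (hz : z ∈ Ioo (0 : ℝ) 1) (hz' : z' ∈ Ioo (0 : ℝ) 1) :
    AnalyticAt ℂ (fun ω => exponentFactor (d.ρ₀ ω) (d.ρ₁ ω) z /
      exponentFactor (d.ρ₀ ω) (d.ρ₁ ω) z') ω₀ := by
  have h1 := hpω z hz ω₀ hω₀
  have h2 := hpω z' hz' ω₀ hω₀
  have h3 : AnalyticAt ℂ (fun ω => Complex.exp ((p z' ω - p z ω +
      (d.c ω * ((Real.log z : ℂ) - Real.log z') + (d.a ω + d.b ω - d.c ω + 1) *
        ((Real.log (1 - z) : ℂ) - Real.log (1 - z')))) / 2)) ω₀ := by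
    fun_prop
  refine h3.congr ?_
  filter_upwards [hU.mem_nhds hω₀] with ω hω
  obtain ⟨k, hk⟩ := (hred ω hω).primitive_eq (hδ ω hω) (hp ω hω)
  rw [exponentFactor_eq_exp _ _ hz, exponentFactor_eq_exp _ _ hz', ← Complex.exp_sub]
  congr 1
  linear_combination (hk z' hz' - hk z hz) / 2

/-- The regular part of the Green's function: dividing by the quantization function gives
`-green`. -/
theorem analyticAt_Rin_mul_RB_div {P Q p : ℝ → ℂ → ℂ} {U : Set ℂ} {ω₀ : ℂ} (hU : IsOpen U)
    (hω₀ : ω₀ ∈ U) (hred : ∀ ω ∈ U, d.ReducesToGauss P Q ω)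
    (hp : ∀ ω ∈ U, ∀ z ∈ Ioo (0 : ℝ) 1, HasDerivAt (fun x => p x ω) (P z ω) z)
    (hpω : ∀ z ∈ Ioo (0 : ℝ) 1, AnalyticOnNhd ℂ (p z) U)
    (ha : AnalyticAt ℂ d.a ω₀) (hb : AnalyticAt ℂ d.b ω₀) (hc : AnalyticAt ℂ d.c ω₀)
    (hc0 : ∀ k : ℕ, d.c ω₀ ≠ -k) (hδ : ∀ ω ∈ U, ∀ k : ℤ, d.c ω - d.a ω - d.b ω ≠ k)
    (α β : ℂ) {x y z : ℝ} (hx : x ∈ Ioo (0 : ℝ) 1) (hy : y ∈ Ioo (0 : ℝ) 1)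
    (hz : z ∈ Ioo (0 : ℝ) 1) :
    AnalyticAt ℂ (fun ω => d.Rin x ω * d.RB α β y ω / (Complex.exp (p z ω) * d.Wsf z ω)) ω₀ := by
  have hδ0 := hδ ω₀ hω₀
  have hpz := hpω z hz ω₀ hω₀
  have h1 := d.analyticAt_exponentFactor_div hU hω₀ hred hp hpω ha hb hc hδ hx hz
  have h2 := d.analyticAt_exponentFactor_div hU hω₀ hred hp hpω ha hb hc hδ hy hz
  have h3 := analyticAt_ordinaryHypergeometric_param ha hb hc hc0 (norm_ofReal_lt_one hx)
  have h4 := ((analyticAt_kummerSlow ha hb hc hδ0 hy).const_smul (c := β)).sub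
    ((analyticAt_kummerFast ha hb hc hδ0 hy).const_smul (c := α))
  have h5 := ((analyticAt_kummerSlow ha hb hc hδ0 hz).mul
    (analyticAt_kummerFastDeriv ha hb hc hδ0 hz)).sub
    ((analyticAt_kummerFast ha hb hc hδ0 hz).mul (analyticAt_kummerSlowDeriv ha hb hc hδ0 hz))
  have h6 := ((h1.mul h2).mul (h3.mul h4)).div (hpz.cexp.mul h5)
    (mul_ne_zero (Complex.exp_ne_zero _) (wronskian_kummer_ne_zero hδ0 hz))
  refine h6.congr ?_
  filter_upwards [hU.mem_nhds hω₀] with ω hω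
  have hA := exponentFactor_ne_zero (d.ρ₀ ω) (d.ρ₁ ω) hz
  have hW := wronskian_kummer_ne_zero (hδ ω hω) hz
  rw [d.Wsf_eq (hδ ω hω) hz, RB, Rin_eq, Rslow_eq, d.Rfast_eq hy]
  simp only [Pi.div_apply, Pi.mul_apply, Pi.sub_apply, Pi.smul_apply, smul_eq_mul,
    Function.comp_apply] at hW ⊢
  generalize kummerSlow (d.a ω) (d.b ω) (d.c ω) z * kummerFastDeriv (d.a ω) (d.b ω) (d.c ω) z -
    kummerFast (d.a ω) (d.b ω) (d.c ω) z * kummerSlowDeriv (d.a ω) (d.b ω) (d.c ω) z = W at *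
  have := Complex.exp_ne_zero (p z ω)
  field_simp

theorem analyticAt_F {ω₀ : ℂ} (ha : AnalyticAt ℂ d.a ω₀) (hb : AnalyticAt ℂ d.b ω₀)
    (hc : AnalyticAt ℂ d.c ω₀) (hc0 : ∀ k : ℕ, d.c ω₀ ≠ -k)
    (hδ : ∀ k : ℤ, d.c ω₀ - d.a ω₀ - d.b ω₀ ≠ k) (α β : ℂ) : AnalyticAt ℂ (d.F α β) ω₀ := by
  have h1 := analyticAt_gamma hc hc0
  have h2 := analyticAt_gamma (f := fun ω => d.c ω - d.a ω - d.b ω) (by fun_prop)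
    fun k hk => hδ (-k) (by push_cast; exact hk)
  have h3 := analyticAt_gamma (f := fun ω => d.a ω + d.b ω - d.c ω) (by fun_prop)
    fun k hk => hδ k (by push_cast; linear_combination -hk)
  have h4 := analyticAt_inv_gamma (hc.sub ha)
  have h5 := analyticAt_inv_gamma (hc.sub hb)
  have h6 := analyticAt_inv_gamma ha
  have h7 := analyticAt_inv_gamma hb
  refine ((((h1.mul h2).mul (h4.mul h5)).const_smul (c := α)).add
    (((h1.mul h3).mul (h6.mul h7)).const_smul (c := β))).congr (.of_forall fun ω => ?_)
  simp only [F, Cslow, Cfast, div_eq_mul_inv, mul_inv, Pi.add_apply, Pi.smul_apply, Pi.mul_apply,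
    Pi.sub_apply, smul_eq_mul]

theorem connection_ne_zero (hc : ∀ k : ℕ, d.c ω ≠ -k)
    (hδ : ∀ k : ℤ, d.c ω - d.a ω - d.b ω ≠ k) (hs : d.Cslow ω = 0) : d.Cfast ω ≠ 0 := by
  intro hf
  have h1 := tendsto_zero_hypergeometric (d.a ω) (d.b ω) hc
  refine one_ne_zero (tendsto_nhds_unique h1 (tendsto_const_nhds.congr' ?_))
  filter_upwards [Ioo_mem_nhdsGT (zero_lt_one' ℝ)] with x hx
  have h2 := d.Rin_eq_add hc hδ hx
  rw [hs, hf, Rin_eq, zero_mul, zero_mul, add_zero] at h2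
  exact ((mul_eq_zero.1 h2).resolve_left (exponentFactor_ne_zero _ _ hx)).symm

/-- At a zero of the quantization function the outer solution is a multiple of the ingoing one. -/
theorem exists_RB_eq_mul_Rin (hc : ∀ k : ℕ, d.c ω ≠ -k)
    (hδ : ∀ k : ℤ, d.c ω - d.a ω - d.b ω ≠ k) {α β : ℂ} (hαβ : (α, β) ≠ (0, 0))
    (hF : d.F α β ω = 0) :
    ∃ χ : ℂ, χ ≠ 0 ∧ (∀ z ∈ Ioo (0 : ℝ) 1, d.RB α β z ω = χ * d.Rin z ω) ∧
      (β ≠ 0 → d.Cslow ω ≠ 0 ∧ χ = β / d.Cslow ω) ∧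
      (α ≠ 0 → d.Cfast ω ≠ 0 ∧ χ = -α / d.Cfast ω) := by
  have hne := d.connection_ne_zero hc hδ
  have hF' : α * d.Cslow ω + β * d.Cfast ω = 0 := hF
  have hs : β ≠ 0 → d.Cslow ω ≠ 0 := fun hβ h0 => hne h0 (by simpa [h0, hβ] using hF')
  have hf : α ≠ 0 → d.Cfast ω ≠ 0 := fun hα h0 =>
    hne (by simpa [h0, hα] using hF') h0
  by_cases hβ : β = 0
  · have hα : α ≠ 0 := by rintro rfl; exact hαβ (by rw [hβ])
    have hf0 := hf hα
    have hs0 : d.Cslow ω = 0 := by simpa [hβ, hα] using hF'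
    refine ⟨-α / d.Cfast ω, div_ne_zero (neg_ne_zero.2 hα) hf0, fun z hz => ?_,
      fun h => absurd hβ h, fun _ => ⟨hf0, rfl⟩⟩
    rw [d.Rin_eq_add hc hδ hz, RB, hs0, hβ]
    field_simp
    ring
  · have hs0 := hs hβ
    refine ⟨β / d.Cslow ω, div_ne_zero hβ hs0, fun z hz => ?_, fun _ => ⟨hs0, rfl⟩,
      fun h => ⟨hf h, ?_⟩⟩
    · rw [d.Rin_eq_add hc hδ hz, RB]
      field_simp
      linear_combination -d.Rfast z ω * hF'
    · have := hf h
      field_simp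
      linear_combination hF'

end HypData

theorem theorem1
    (d : HypData) (P Q p : ℝ → ℂ → ℂ) (w : ℝ → ℂ → ℂ) (α β : ℂ) (U : Set ℂ) (ωn : ℂ)
    (hU : IsOpen U) (hωn : ωn ∈ U) (hαβ : (α, β) ≠ (0, 0))
    -- the radial equation belongs to the hypergeometric class
    (hred : ∀ ω ∈ U, d.ReducesToGauss P Q ω)
    -- the integrating factor `w = exp (∫ P dz)`
    (hp : ∀ ω ∈ U, ∀ z ∈ Ioo (0 : ℝ) 1, HasDerivAt (fun x => p x ω) (P z ω) z)
    (hpω : ∀ z ∈ Ioo (0 : ℝ) 1, AnalyticOnNhd ℂ (p z) U)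
    (hw : ∀ ω ∈ U, ∀ z ∈ Ioo (0 : ℝ) 1, w z ω = Complex.exp (p z ω))
    -- the hypergeometric series of the ingoing solution is defined
    (hc : ∀ ω ∈ U, ∀ k : ℕ, d.c ω ≠ -(k : ℂ))
    -- A1
    (hA1a : AnalyticOnNhd ℂ d.a U) (hA1b : AnalyticOnNhd ℂ d.b U) (hA1c : AnalyticOnNhd ℂ d.c U)
    -- A2
    (hA2 : ∀ ω ∈ U, ∀ k : ℤ, d.c ω - d.a ω - d.b ω ≠ (k : ℂ))
    -- A3
    (hA3 : ∀ ω ∈ U, ∀ s t : ℂ,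
      (∀ᶠ z in 𝓝[<] (1 : ℝ), s * d.Rslow z ω + t * d.Rfast z ω = 0) → s = 0 ∧ t = 0)
    -- A4
    (hA4 : ∀ ω ∈ U, ∀ z ∈ Ioo (0 : ℝ) 1, w z ω * d.Wsf z ω ≠ 0)
    -- a simple zero of the quantization function
    (hF : d.F α β ωn = 0) (hF' : deriv (d.F α β) ωn ≠ 0) :
    ∃ χ : ℂ, χ ≠ 0 ∧
      (∀ z ∈ Ioo (0 : ℝ) 1, d.RB α β z ωn = χ * d.Rin z ωn) ∧
      (β ≠ 0 → d.Cslow ωn ≠ 0 ∧ χ = β / d.Cslow ωn) ∧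
      (α ≠ 0 → d.Cfast ωn ≠ 0 ∧ χ = -α / d.Cfast ωn) ∧
      -- Laurent expansion with the exact residue
      (∀ z ∈ Ioo (0 : ℝ) 1, ∀ z' ∈ Ioo (0 : ℝ) 1,
        HasSimplePolePart (d.green w α β z z') ωn
          (-(χ * d.Rin z ωn * d.Rin z' ωn) /
            (w z' ωn * d.Wsf z' ωn * deriv (d.F α β) ωn))) ∧
      -- the pole is genuine exactly away from the nodes of the mode, and the nodes are isolated
      (∀ z ∈ Ioo (0 : ℝ) 1, ∀ z' ∈ Ioo (0 : ℝ) 1,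
        (meromorphicOrderAt (d.green w α β z z') ωn = -1 ↔
          d.Rin z ωn ≠ 0 ∧ d.Rin z' ωn ≠ 0)) ∧
      (∀ x ∈ Ioo (0 : ℝ) 1, ∀ᶠ z in 𝓝[≠] x, d.Rin z ωn ≠ 0) ∧
      -- the Abel-weighted Wronskian does not depend on the evaluation point
      (∀ x ∈ Ioo (0 : ℝ) 1, ∀ y ∈ Ioo (0 : ℝ) 1,
        w x ωn * d.Wsf x ωn = w y ωn * d.Wsf y ωn) := by
  have hc0 := hc ωn hωn
  have hδ0 := hA2 ωn hωn
  have ha := hA1a ωn hωn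
  have hb := hA1b ωn hωn
  have hc' := hA1c ωn hωn
  obtain ⟨χ, hχ, hRB, hβ, hα⟩ := d.exists_RB_eq_mul_Rin hc0 hδ0 hαβ hF
  have hres : ∀ z ∈ Ioo (0 : ℝ) 1, ∀ z' ∈ Ioo (0 : ℝ) 1,
      HasSimplePolePart (d.green w α β z z') ωn
        (-(χ * d.Rin z ωn * d.Rin z' ωn) /
          (w z' ωn * d.Wsf z' ωn * deriv (d.F α β) ωn)) := by
    intro z hz z' hz'
    have hmin : min z z' ∈ Ioo (0 : ℝ) 1 := by rcases min_choice z z' with h | h <;> rwa [h]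
    have hmax : max z z' ∈ Ioo (0 : ℝ) 1 := by rcases max_choice z z' with h | h <;> rwa [h]
    have h1 := hasSimplePolePart_div (d.analyticAt_Rin_mul_RB_div hU hωn hred hp hpω ha hb hc' hc0
      hA2 α β hmin hmax hz').neg (d.analyticAt_F ha hb hc' hc0 hδ0 α β) hF hF'
    have hsym : d.Rin (min z z') ωn * d.Rin (max z z') ωn = d.Rin z ωn * d.Rin z' ωn := by
      rcases le_total z z' with h | h
      · rw [min_eq_left h, max_eq_right h]
      · rw [min_eq_right h, max_eq_left h, mul_comm]
    convert h1.congr ?_ using 1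
    · rw [Pi.neg_apply, hRB _ hmax, hw ωn hωn z' hz', mul_left_comm, hsym, neg_div, neg_div,
        div_mul_eq_div_div, mul_assoc]
    · filter_upwards [nhdsWithin_le_nhds (hU.mem_nhds hωn)] with ω hω
      rw [HypData.green, d.wronskian_Rin_RB (hc ω hω) (hA2 ω hω) α β hz', hw ω hω z' hz',
        Pi.neg_apply, neg_div, div_div, mul_neg, div_neg]
      ring_nf
  refine ⟨χ, hχ, hRB, hβ, hα, hres, fun z hz z' hz' => ?_, fun x hx => ?_, fun x hx y hy => ?_⟩
  · rw [(hres z hz z' hz').meromorphicOrderAt_eq_neg_one_iff]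
    have hD := mul_ne_zero (hA4 ωn hωn z' hz') hF'
    rw [Ne, div_eq_zero_iff, neg_eq_zero, mul_eq_zero, mul_eq_zero]
    tauto
  · have hIoo : ∀ᶠ z in 𝓝[≠] x, z ∈ Ioo (0 : ℝ) 1 := nhdsWithin_le_nhds (Ioo_mem_nhds hx.1 hx.2)
    filter_upwards [eventually_ordinaryHypergeometric_ne_zero (d.a ωn) (d.b ωn) hc0 hx, hIoo]
      with z hz hz01
    exact mul_ne_zero (exponentFactor_ne_zero _ _ hz01) hz
  · obtain ⟨k, hk⟩ := d.weighted_Wsf_eq (hred ωn hωn) hδ0 (hp ωn hωn)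
    rw [hw ωn hωn x hx, hw ωn hωn y hy, hk x hx, hk y hy]
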